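/- Fix constants $c_1,c_2\ge 0$. There is a constant $C>0$, depending only on $c_1,c_2$, such that the following holds. Let $n,d$ be natural numbers with $n\le (d+1)^{c_2}$ (for instance $n=d$), let $t\in\mathbb R$ be a threshold with $\phi(t)\ge (d+1)^{-c_2}$, where $\phi$ is the standard normal density, let $\varepsilon_2,\varepsilon_3\in(0,1]$ and $\delta\in(0,1)$, and let $m$ be any natural number with $$m\ \ge\ C\left(\frac{d}{\varepsilon_3\varepsilon_2}\right)^{C}\log\frac{2}{\delta}.$$ Then there is a (measurable) estimator $A$, depending only on the data fixed so far, which maps $m$ labelled samples in $\mathbb R^n\times\mathbb R$ to $d$ vectors in $\mathbb R^n$ and has the following property. Let $\mathbf w_1^*,\dots,\mathbf w_d^*\in\mathbb R^n$ be unit vectors such that for all $i\neq j$ the angle between $\mathbf w_i^*$ and $\mathbf w_j^*$ lies in $[(d+1)^{-c_2},\,\pi-(d+1)^{-c_2}]$. Let $P\in\mathbb R[X_1,\dots,X_d]$ have degree at most $1$ in each variable and satisfy $|P(X)|\le\|X\|^{c_1}$ (Euclidean norm) for all $X\in\{0,1\}^d$. Let $u(a)=\mathrm{sgn}(a-t)$,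 where $\mathrm{sgn}(a)=1$ if $a\ge 0$ and $\mathrm{sgn}(a)=0$ otherwise; for a polynomial $R$ write $R[\mathbf x]=R\big(u(\mathbf w_1^{*T}\mathbf x),\dots,u(\mathbf w_d^{*T}\mathbf x)\big)$, and let $f(\mathbf x)=P[\mathbf x]$ and $Q_i=\partial P/\partial X_i$. Suppose that, for $\mathbf x\sim\mathcal N(0,I_n)$, $$\mathbb E\big[\,Q_i[\mathbf x]\ \big|\ \mathbf w_i^{*T}\mathbf x=t\,\big]\ \ge\ \varepsilon_3\qquad\text{for every } i,$$ where the law of $\mathbf x$ given $\mathbf w_i^{*T}\mathbf x=t$ is the standard Gaussian on the hyperplane $\{\mathbf w_i^{*T}\mathbf x=t\}$, that is, the law of $\mathbf x-(\mathbf w_i^{*T}\mathbf x)\mathbf w_i^*+t\,\mathbf w_i^*$. If $\mathbf x_1,\dots,\mathbf x_m$ are independent with law $\mathcal N(0,I_n)$, then with probability at least $1-\delta$ the output of $A$ on $(\mathbf x_1,f(\mathbf x_1)),\dots,(\mathbf x_m,f(\mathbf x_m))$ consists of unit vectors $\mathbf v_1,\dots,\mathbf v_d$ such that, for some permutation $\sigma$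 of $\{1,\dots,d\}$, the angle between $\mathbf v_i$ and $\mathbf w^*_{\sigma(i)}$ is at most $\varepsilon_2$ for every $i$. In short: $\mathrm{poly}\big(d/(\varepsilon_3\varepsilon_2)\big)$ samples suffice to determine all the $\mathbf w_i^*$ within error $\varepsilon_2$. -/

import Mathlib

open MeasureTheory ProbabilityTheory InnerProductGeometry
open scoped RealInnerProductSpace

/-- The `0/1`-valued sign activation: `1` on `[0, ∞)` and `0` on `(-∞, 0)`. -/
noncomputable def sgnAct (a : ℝ) : ℝ := if 0 ≤ a then 1 else 0

/-- The values `X_i = u_t(w_iᵀ x) = sgn (w_iᵀ x - t)` of the first layer at the input `x`. -/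
noncomputable def firstLayer {n d : ℕ} (w : Fin d → EuclideanSpace ℝ (Fin n)) (t : ℝ)
    (x : EuclideanSpace ℝ (Fin n)) : Fin d → ℝ :=
  fun i => sgnAct (⟪w i, x⟫ - t)

/-- `P[x]`: the polynomial `P` with `X_i = sgn (w_iᵀ x - t)` substituted. -/
noncomputable def evalAt {n d : ℕ} (P : MvPolynomial (Fin d) ℝ)
    (w : Fin d → EuclideanSpace ℝ (Fin n)) (t : ℝ) (x : EuclideanSpace ℝ (Fin n)) : ℝ :=
  MvPolynomial.eval (firstLayer w t x) P

/-- For a unit vector `v`, the conditional expectation `E[g(x) | vᵀ x = s]` of a standard Gaussian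
vector `x`. The coordinate `vᵀ x` is independent of the projection `x - (vᵀ x) v` of `x` to the
hyperplane orthogonal to `v`, so that the law of `x` given `vᵀ x = s` is the law of
`(x - (vᵀ x) v) + s v`. -/
noncomputable def condMeanOnHyperplane {n : ℕ} (v : EuclideanSpace ℝ (Fin n)) (s : ℝ)
    (g : EuclideanSpace ℝ (Fin n) → ℝ) : ℝ :=
  ∫ x, g ((x - ⟪v, x⟫ • v) + s • v) ∂(stdGaussian (EuclideanSpace ℝ (Fin n)))

/-- The labelled sample `(x_1, f(x_1)), …, (x_m, f(x_m))` (labels without noise). -/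
def labelledSample {n m : ℕ} (f : EuclideanSpace ℝ (Fin n) → ℝ)
    (x : Fin m → EuclideanSpace ℝ (Fin n)) : Fin m → EuclideanSpace ℝ (Fin n) × ℝ :=
  fun j => (x j, f (x j))

/-- `v` recovers the unit vectors `w` within error `ε`: it consists of unit vectors, and up to
a relabelling of the indices the angle between corresponding vectors is at most `ε`. -/
def RecoversWithin {n d : ℕ} (ε : ℝ) (v w : Fin d → EuclideanSpace ℝ (Fin n)) : Prop :=
  ∃ σ : Equiv.Perm (Fin d), ∀ i, ‖v i‖ = 1 ∧ angle (v i) (w (σ i)) ≤ ε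

/-!
Write `f(x) = P(u(w_1ᵀ x), …, u(w_dᵀ x))` and `M_v(s) = E[f(x) | vᵀ x = s]` for a unit vector `v`.
The vectors `w_i` are recognised as the directions in which `M_v` jumps up at `s = t`.

* For `v = w_i` the `i`-th threshold is constant on each hyperplane `vᵀ x = s` and switches from `0`
  to `1` at `s = t`. As `P` has degree at most one in `X_i`, the function `M_v` jumps there by
  `E[Q_i[x] | w_iᵀ x = t] ≥ ε₃`. The other thresholds contribute a Lipschitz function of `s`, since
  moving the hyperplane by `Δ` flips `u(w_jᵀ x)` only if a Gaussian of variance `1 - ⟨v, w_j⟩²` falls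
  into an interval of length at most `Δ` (`abs_condMean_sub_le`, `le_condMean_self_sub`).
* For `v` far from all the lines `ℝ w_j` the same argument shows that `M_v` is Lipschitz, with a
  constant that grows as `v` approaches a line. For `v = -w_j` the function can only jump down.

The jump is measured by `jumpStat f t h v = E[f(x) ψ_h(vᵀ x - t)]` with the odd bump `ψ_h`, which is
an average of density-weighted differences `M_v(t + u) - M_v(t - u)` with `0 < u < 2h`
(`jumpStat_eq_integral`) and is Lipschitz in `v` (`abs_jumpStat_sub_le`). One scale `h` does not
handle the directions whose distance to some `-w_j` is comparable to `h`, and two scales do: at a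
coarse scale the value at `-w_j` is small, hence also near `-w_j` by Lipschitz continuity in `v`;
at a scale fine enough for the remaining directions, the value is small away from all the lines. So a
direction with a large statistic at both scales is close to some `w_j`
(`Regular.exists_norm_sub_lt`).

The estimator replaces expectations by empirical means, keeps the directions of a finite net of the
sphere with large statistics at both scales, and returns any `d` of them that are pairwise separated.
Since the `w_j` are themselves separated, such a tuple exists and matches the `w_j` up to a
permutation (`Regular.exists_perm_norm_sub_lt`). The logarithm of the size of the net is polynomial,
so Hoeffding's inequality and a union bound give the sample size
(`Regular.one_sub_le_measureReal`). All parameters are powers of one size `Z`, which is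
polynomial in `d / (ε₃ ε₂)`.
-/

/-! ### One-dimensional Gaussian estimates -/

lemma gaussianPDFReal_zero_one (x : ℝ) :
    gaussianPDFReal 0 1 x = (√(2 * Real.pi))⁻¹ * Real.exp (-x ^ 2 / 2) := by
  simp [gaussianPDFReal]

lemma inv_sqrt_two_pi_le_one : (√(2 * Real.pi))⁻¹ ≤ 1 := by
  apply inv_le_one_of_one_le₀
  rw [Real.one_le_sqrt]
  linarith [Real.pi_gt_three]

lemma gaussianPDFReal_zero_one_le_one (x : ℝ) : gaussianPDFReal 0 1 x ≤ 1 := by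
  rw [gaussianPDFReal_zero_one]
  have h : Real.exp (-x ^ 2 / 2) ≤ 1 := Real.exp_le_one_iff.2 (by nlinarith [sq_nonneg x])
  exact mul_le_one₀ inv_sqrt_two_pi_le_one (Real.exp_pos _).le h

lemma hasDerivAt_gaussianPDFReal_zero_one (x : ℝ) :
    HasDerivAt (gaussianPDFReal 0 1) (-x * gaussianPDFReal 0 1 x) x := by
  have h : HasDerivAt (fun y : ℝ => (√(2 * Real.pi))⁻¹ * Real.exp (-y ^ 2 / 2))
      ((√(2 * Real.pi))⁻¹ * (Real.exp (-x ^ 2 / 2) * (-(2 * x) / 2))) x := by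
    have h1 : HasDerivAt (fun y : ℝ => -y ^ 2 / 2) (-(2 * x) / 2) x := by
      simpa using ((hasDerivAt_pow 2 x).neg.div_const 2)
    exact (h1.exp).const_mul _
  have e : gaussianPDFReal 0 1 = fun y : ℝ => (√(2 * Real.pi))⁻¹ * Real.exp (-y ^ 2 / 2) :=
    funext gaussianPDFReal_zero_one
  rw [e]
  convert h using 1
  ring

lemma abs_gaussianPDFReal_sub_le (x y : ℝ) :
    |gaussianPDFReal 0 1 x - gaussianPDFReal 0 1 y| ≤ |x - y| := by
  have h := Convex.norm_image_sub_le_of_norm_deriv_le (𝕜 := ℝ) (f := gaussianPDFReal 0 1)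
    (s := Set.univ) (x := y) (y := x) (C := 1)
    (fun z _ => (hasDerivAt_gaussianPDFReal_zero_one z).differentiableAt) ?_ convex_univ
    (Set.mem_univ _) (Set.mem_univ _)
  · simpa using h
  intro z _
  rw [(hasDerivAt_gaussianPDFReal_zero_one z).deriv, gaussianPDFReal_zero_one, Real.norm_eq_abs,
    abs_mul, abs_neg, abs_mul, abs_of_nonneg (Real.exp_pos _).le,
    abs_of_nonneg (inv_nonneg.2 (Real.sqrt_nonneg _))]
  -- `|z| ≤ 1 + z² / 2 ≤ exp (z² / 2)`
  have h1 : |z| ≤ Real.exp (z ^ 2 / 2) := by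
    have := Real.add_one_le_exp (z ^ 2 / 2)
    nlinarith [sq_abs z, sq_nonneg (|z| - 1)]
  have h2 : |z| * Real.exp (-z ^ 2 / 2) ≤ 1 := by
    calc |z| * Real.exp (-z ^ 2 / 2) ≤ Real.exp (z ^ 2 / 2) * Real.exp (-z ^ 2 / 2) := by gcongr
      _ = 1 := by rw [← Real.exp_add]; simp; ring
  calc |z| * ((√(2 * Real.pi))⁻¹ * Real.exp (-z ^ 2 / 2))
      = (√(2 * Real.pi))⁻¹ * (|z| * Real.exp (-z ^ 2 / 2)) := by ring
    _ ≤ 1 * 1 := by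
      gcongr
      exact inv_sqrt_two_pi_le_one
    _ = 1 := one_mul 1

/-- A centred Gaussian of standard deviation `σ` has density at most `1 / σ`. -/
lemma gaussianReal_real_Icc_le {v : NNReal} {σ : ℝ} (hσ : 0 < σ) (hv : σ ^ 2 ≤ v) {a b : ℝ}
    (hab : a ≤ b) : (gaussianReal 0 v).real (Set.Icc a b) ≤ (b - a) / σ := by
  have hv0 : v ≠ 0 := by
    rintro rfl
    have : 0 < σ ^ 2 := by positivity
    simp at hv
    linarith
  have hpdf : ∀ x, gaussianPDFReal 0 v x ≤ 1 / σ := by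
    intro x
    rw [gaussianPDFReal]
    have h1 : Real.exp (-(x - 0) ^ 2 / (2 * v)) ≤ 1 := by
      apply Real.exp_le_one_iff.2
      apply div_nonpos_of_nonpos_of_nonneg
      · nlinarith [sq_nonneg x]
      · positivity
    have h2 : (√(2 * Real.pi * v))⁻¹ ≤ 1 / σ := by
      rw [one_div]
      apply inv_anti₀ hσ
      apply Real.le_sqrt_of_sq_le
      nlinarith [Real.pi_gt_three, sq_nonneg σ]
    calc _ ≤ (1 / σ) * 1 := by gcongr
      _ = 1 / σ := mul_one _
  rw [measureReal_def, gaussianReal_apply_eq_integral 0 hv0, ENNReal.toReal_ofReal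
    (integral_nonneg fun x => gaussianPDFReal_nonneg _ _ _)]
  calc ∫ x in Set.Icc a b, gaussianPDFReal 0 v x ≤ ∫ _ in Set.Icc a b, 1 / σ :=
        integral_mono (integrable_gaussianPDFReal 0 v).integrableOn
          (integrable_const _) hpdf
    _ = (b - a) / σ := by
      simp [hab]
      ring

/-! ### Disintegration of the standard Gaussian along a direction -/

lemma map_inner_stdGaussian {n : ℕ} (a : EuclideanSpace ℝ (Fin n)) :
    (stdGaussian (EuclideanSpace ℝ (Fin n))).map (fun x => ⟪a, x⟫) =
      gaussianReal 0 (‖a‖₊ ^ 2) := by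
  have h := IsGaussian.map_eq_gaussianReal (μ := stdGaussian (EuclideanSpace ℝ (Fin n)))
    (innerSL ℝ a)
  have e : (⇑(innerSL ℝ a) : EuclideanSpace ℝ (Fin n) → ℝ) = fun x => ⟪a, x⟫ := rfl
  rw [variance_dual_stdGaussian, integral_strongDual_stdGaussian, e, innerSL_apply_norm] at h
  rw [h]
  congr 1
  ext
  simp

lemma cov_inner_stdGaussian {n : ℕ} (a b : EuclideanSpace ℝ (Fin n)) :
    cov[fun x => ⟪a, x⟫, fun x => ⟪b, x⟫; stdGaussian (EuclideanSpace ℝ (Fin n))] = ⟪a, b⟫ := by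
  rw [← covarianceBilin_apply_eq_cov (IsGaussian.memLp_two_id), covarianceBilin_stdGaussian]
  rfl

/-- The coordinate along `v` is independent of the projection orthogonal to `v`. -/
lemma indepFun_inner_sub_stdGaussian {n : ℕ} {v : EuclideanSpace ℝ (Fin n)} (hv : ‖v‖ = 1) :
    IndepFun (fun x => ⟪v, x⟫) (fun x => x - ⟪v, x⟫ • v)
      (stdGaussian (EuclideanSpace ℝ (Fin n))) := by
  have hvv : ⟪v, v⟫ = 1 := by rw [real_inner_self_eq_norm_sq, hv]; norm_num
  let L : EuclideanSpace ℝ (Fin n) →L[ℝ] ℝ × EuclideanSpace ℝ (Fin n) :=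
    (innerSL ℝ v).prod (ContinuousLinearMap.id ℝ _ - (innerSL ℝ v).smulRight v)
  have hL : HasGaussianLaw
      (fun x : EuclideanSpace ℝ (Fin n) => ((⟪v, x⟫ : ℝ), x - ⟪v, x⟫ • v))
      (stdGaussian (EuclideanSpace ℝ (Fin n))) :=
    (IsGaussian.hasGaussianLaw_id (μ := stdGaussian (EuclideanSpace ℝ (Fin n)))).map_fun L
  apply hL.indepFun_of_covariance_inner
  intro a b
  have e1 : (fun x : EuclideanSpace ℝ (Fin n) => ⟪a, (⟪v, x⟫ : ℝ)⟫) =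
      fun x => ⟪a • v, x⟫ := by
    funext x
    simp [real_inner_smul_left, mul_comm]
  have e2 : (fun x : EuclideanSpace ℝ (Fin n) => ⟪b, x - ⟪v, x⟫ • v⟫) =
      fun x => ⟪b - ⟪b, v⟫ • v, x⟫ := by
    funext x
    simp only [inner_sub_right, inner_sub_left, real_inner_smul_left, real_inner_smul_right]
    ring
  rw [e1, e2, cov_inner_stdGaussian]
  simp only [inner_sub_right, real_inner_smul_left, real_inner_smul_right, hvv]
  rw [real_inner_comm]
  ring

/-- The law of `x - ⟨v, x⟩ v + s v`, with `s` an independent standard normal, is standard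
Gaussian. -/
lemma integral_stdGaussian_eq_integral_condMean {n : ℕ} {v : EuclideanSpace ℝ (Fin n)}
    (hv : ‖v‖ = 1) {f : EuclideanSpace ℝ (Fin n) → ℝ} (hf : Measurable f) {B : ℝ}
    (hB : ∀ x, |f x| ≤ B) {ρ : ℝ → ℝ} (hρ : Measurable ρ) {R : ℝ} (hR : ∀ s, |ρ s| ≤ R) :
    ∫ x, f x * ρ ⟪v, x⟫ ∂(stdGaussian (EuclideanSpace ℝ (Fin n))) =
      ∫ s, gaussianPDFReal 0 1 s * (ρ s * condMeanOnHyperplane v s f) := by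
  set γ := stdGaussian (EuclideanSpace ℝ (Fin n)) with hγ
  have m1 : Measurable fun x : EuclideanSpace ℝ (Fin n) => ⟪v, x⟫ := by fun_prop
  have m2 : Measurable fun x : EuclideanSpace ℝ (Fin n) => x - ⟪v, x⟫ • v := by fun_prop
  have hind := (indepFun_iff_map_prod_eq_prod_map_map m1.aemeasurable m2.aemeasurable).1
    (indepFun_inner_sub_stdGaussian hv)
  set G : ℝ × EuclideanSpace ℝ (Fin n) → ℝ := fun p => f (p.2 + p.1 • v) * ρ p.1 with hG
  have hGm : Measurable G := by
    apply Measurable.mul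
    · exact hf.comp (by fun_prop)
    · exact hρ.comp measurable_fst
  have hGb : ∀ p, ‖G p‖ ≤ B * R := by
    intro p
    rw [hG, Real.norm_eq_abs, abs_mul]
    exact mul_le_mul (hB _) (hR _) (abs_nonneg _) ((abs_nonneg _).trans (hB 0))
  have e0 : ∀ x : EuclideanSpace ℝ (Fin n), f x * ρ ⟪v, x⟫ = G (⟪v, x⟫, x - ⟪v, x⟫ • v) := by
    intro x
    simp [hG]
  have : IsProbabilityMeasure (γ.map fun x => x - ⟪v, x⟫ • v) :=
    Measure.isProbabilityMeasure_map m2.aemeasurable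
  have hlaw : γ.map (fun x => ⟪v, x⟫) = gaussianReal 0 1 := by
    rw [hγ, map_inner_stdGaussian]
    congr 1
    ext
    simp [hv]
  simp_rw [e0]
  rw [← integral_map (φ := fun x : EuclideanSpace ℝ (Fin n) => ((⟪v, x⟫ : ℝ), x - ⟪v, x⟫ • v))
    (f := G) (m1.prodMk m2).aemeasurable hGm.aestronglyMeasurable, hind, hlaw, integral_prod]
  · rw [integral_gaussianReal_eq_integral_smul (by norm_num)]
    congr 1
    funext s
    rw [integral_map (f := fun y => G (s, y)) m2.aemeasurable
      (hGm.comp measurable_prodMk_left).aestronglyMeasurable]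
    simp only [hG, condMeanOnHyperplane, smul_eq_mul, integral_mul_const]
    rw [mul_comm (ρ s)]
  · exact Integrable.of_bound hGm.aestronglyMeasurable _ (Filter.Eventually.of_forall hGb)

/-! ### Conditional means as functions of the height of the hyperplane -/

lemma sgnAct_eq_zero_or_one (a : ℝ) : sgnAct a = 0 ∨ sgnAct a = 1 := by
  unfold sgnAct
  split_ifs <;> simp

lemma measurable_sgnAct : Measurable sgnAct :=
  Measurable.ite measurableSet_Ici measurable_const measurable_const

lemma measurable_firstLayer {n d : ℕ} (w : Fin d → EuclideanSpace ℝ (Fin n)) (t : ℝ) :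
    Measurable (firstLayer w t) :=
  measurable_pi_iff.2 fun i => measurable_sgnAct.comp (by fun_prop)

lemma firstLayer_eq_zero_or_one {n d : ℕ} (w : Fin d → EuclideanSpace ℝ (Fin n)) (t : ℝ)
    (x : EuclideanSpace ℝ (Fin n)) (i : Fin d) :
    firstLayer w t x i = 0 ∨ firstLayer w t x i = 1 :=
  sgnAct_eq_zero_or_one _

/-- The function `x ↦ p (u(w_1ᵀ x), …, u(w_dᵀ x))` for an arbitrary function `p` in place of a
polynomial. -/
noncomputable def layerFun {n d : ℕ} (p : (Fin d → ℝ) → ℝ)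
    (w : Fin d → EuclideanSpace ℝ (Fin n)) (t : ℝ) (x : EuclideanSpace ℝ (Fin n)) : ℝ :=
  p (firstLayer w t x)

/-- `|p| ≤ B` on the vertices of the cube `{0, 1}^d`. -/
def CubeBound {d : ℕ} (p : (Fin d → ℝ) → ℝ) (B : ℝ) : Prop :=
  ∀ X, (∀ i, X i = 0 ∨ X i = 1) → |p X| ≤ B

lemma measurable_layerFun {n d : ℕ} {p : (Fin d → ℝ) → ℝ} (hp : Measurable p)
    (w : Fin d → EuclideanSpace ℝ (Fin n)) (t : ℝ) : Measurable (layerFun p w t) :=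
  hp.comp (measurable_firstLayer w t)

lemma CubeBound.abs_layerFun_le {n d : ℕ} {p : (Fin d → ℝ) → ℝ} {B : ℝ} (hB : CubeBound p B)
    (w : Fin d → EuclideanSpace ℝ (Fin n)) (t : ℝ) (x : EuclideanSpace ℝ (Fin n)) :
    |layerFun p w t x| ≤ B :=
  hB _ (firstLayer_eq_zero_or_one w t x)

lemma CubeBound.nonneg {d : ℕ} {p : (Fin d → ℝ) → ℝ} {B : ℝ} (hB : CubeBound p B) : 0 ≤ B :=
  (abs_nonneg _).trans (hB 0 fun _ => Or.inl rfl)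

lemma inner_hyperplanePoint {n : ℕ} (v a x : EuclideanSpace ℝ (Fin n)) (s : ℝ) :
    ⟪a, (x - ⟪v, x⟫ • v) + s • v⟫ = ⟪a - ⟪v, a⟫ • v, x⟫ + s * ⟪v, a⟫ := by
  simp only [inner_add_right, inner_sub_right, inner_sub_left, real_inner_smul_left,
    real_inner_smul_right, real_inner_comm a v]
  ring

lemma inner_self_hyperplanePoint {n : ℕ} {v : EuclideanSpace ℝ (Fin n)} (hv : ‖v‖ = 1)
    (x : EuclideanSpace ℝ (Fin n)) (s : ℝ) : ⟪v, (x - ⟪v, x⟫ • v) + s • v⟫ = s := by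
  have hvv : ⟪v, v⟫ = 1 := by rw [real_inner_self_eq_norm_sq, hv]; norm_num
  rw [inner_hyperplanePoint, hvv]
  simp

/-- Moving the hyperplane `vᵀ x = s` to `vᵀ x = s'` crosses the threshold of a unit `a` only if a
Gaussian of variance `1 - ⟨v, a⟩²` falls into an interval of length `|⟨v, a⟩| |s - s'|`. -/
lemma measureReal_flip_le {n : ℕ} {v a : EuclideanSpace ℝ (Fin n)} (hv : ‖v‖ = 1) (ha : ‖a‖ = 1)
    {σ : ℝ} (hσ : 0 < σ) (hva : σ ^ 2 ≤ 1 - ⟪v, a⟫ ^ 2) (t s s' : ℝ) :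
    (stdGaussian (EuclideanSpace ℝ (Fin n))).real
      {x | sgnAct (⟪a, (x - ⟪v, x⟫ • v) + s • v⟫ - t) ≠
        sgnAct (⟪a, (x - ⟪v, x⟫ • v) + s' • v⟫ - t)} ≤ |s - s'| / σ := by
  set c : ℝ := ⟪v, a⟫ with hc
  set b := a - c • v with hb
  have hvv : ⟪v, v⟫ = 1 := by rw [real_inner_self_eq_norm_sq, hv]; norm_num
  have haa : ⟪a, a⟫ = 1 := by rw [real_inner_self_eq_norm_sq, ha]; norm_num
  have hbn : ‖b‖ ^ 2 = 1 - c ^ 2 := by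
    rw [← real_inner_self_eq_norm_sq, hb]
    simp only [inner_sub_left, inner_sub_right, real_inner_smul_left, real_inner_smul_right, hvv,
      haa]
    rw [real_inner_comm v a, ← hc]
    ring
  have hc1 : |c| ≤ 1 := by
    have := abs_real_inner_le_norm v a
    rwa [hv, ha, mul_one] at this
  set l := min (t - s * c) (t - s' * c)
  set r := max (t - s * c) (t - s' * c)
  have hsub : {x | sgnAct (⟪a, (x - ⟪v, x⟫ • v) + s • v⟫ - t) ≠
        sgnAct (⟪a, (x - ⟪v, x⟫ • v) + s' • v⟫ - t)} ⊆
      (fun x => ⟪b, x⟫) ⁻¹' Set.Icc l r := by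
    intro x hx
    simp only [Set.mem_ofPred_eq, inner_hyperplanePoint, ← hc, ← hb, sgnAct] at hx
    simp only [Set.mem_preimage, Set.mem_Icc, l, r, min_le_iff, le_max_iff]
    by_contra hcon
    rw [not_and_or, not_or, not_or] at hcon
    apply hx
    rcases hcon with h | h
    · rw [if_neg (by linarith), if_neg (by linarith)]
    · rw [if_pos (by linarith), if_pos (by linarith)]
  calc _ ≤ (stdGaussian (EuclideanSpace ℝ (Fin n))).real ((fun x => ⟪b, x⟫) ⁻¹' Set.Icc l r) :=
        measureReal_mono hsub
    _ = (gaussianReal 0 (‖b‖₊ ^ 2)).real (Set.Icc l r) := by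
        rw [← map_inner_stdGaussian, map_measureReal_apply (by fun_prop) measurableSet_Icc]
    _ ≤ (r - l) / σ := by
        apply gaussianReal_real_Icc_le hσ _ min_le_max
        push_cast
        rw [hbn]
        exact hva
    _ ≤ |s - s'| / σ := by
        gcongr
        have : r - l = |c| * |s - s'| := by
          rw [max_sub_min_eq_abs, ← abs_mul]
          congr 1
          ring
        rw [this]
        exact mul_le_of_le_one_left (abs_nonneg _) hc1

/-- The conditional mean of `p(u(w_1ᵀ x), …)` given `vᵀ x = s` is Lipschitz in `s` if all the
`w_j` on which `p` depends make an angle with the line of `v` whose sine is at least `σ`. -/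
lemma abs_condMean_sub_le {n d : ℕ} {p : (Fin d → ℝ) → ℝ} (hp : Measurable p) {B : ℝ}
    (hB : CubeBound p B) {J : Finset (Fin d)}
    (hJ : ∀ X Y : Fin d → ℝ, (∀ j ∈ J, X j = Y j) → p X = p Y)
    {w : Fin d → EuclideanSpace ℝ (Fin n)} (hw : ∀ j, ‖w j‖ = 1)
    {v : EuclideanSpace ℝ (Fin n)} (hv : ‖v‖ = 1) {σ : ℝ} (hσ : 0 < σ)
    (hvw : ∀ j ∈ J, σ ^ 2 ≤ 1 - ⟪v, w j⟫ ^ 2) (t s s' : ℝ) :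
    |condMeanOnHyperplane v s (layerFun p w t) - condMeanOnHyperplane v s' (layerFun p w t)| ≤
      2 * B * d / σ * |s - s'| := by
  set γ := stdGaussian (EuclideanSpace ℝ (Fin n)) with hγ
  have hB0 := hB.nonneg
  have hm : ∀ r : ℝ, Measurable fun x : EuclideanSpace ℝ (Fin n) => (x - ⟪v, x⟫ • v) + r • v := by
    intro r
    fun_prop
  have hint : ∀ r : ℝ, Integrable (fun x => layerFun p w t ((x - ⟪v, x⟫ • v) + r • v)) γ :=
    fun r => Integrable.of_bound ((measurable_layerFun hp w t).comp (hm r)).aestronglyMeasurable B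
      (Filter.Eventually.of_forall fun x => hB.abs_layerFun_le w t _)
  set F : Fin d → Set (EuclideanSpace ℝ (Fin n)) := fun j =>
    {x | sgnAct (⟪w j, (x - ⟪v, x⟫ • v) + s • v⟫ - t) ≠
        sgnAct (⟪w j, (x - ⟪v, x⟫ • v) + s' • v⟫ - t)} with hF
  have hFm : ∀ j, MeasurableSet (F j) := by
    intro j
    have h : ∀ r : ℝ, Measurable fun x : EuclideanSpace ℝ (Fin n) =>
        sgnAct (⟪w j, (x - ⟪v, x⟫ • v) + r • v⟫ - t) := fun r =>
      measurable_sgnAct.comp (by fun_prop)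
    exact (measurableSet_eq_fun (h s) (h s')).compl
  have hpt : ∀ x, |layerFun p w t ((x - ⟪v, x⟫ • v) + s • v) -
      layerFun p w t ((x - ⟪v, x⟫ • v) + s' • v)| ≤
      ∑ j ∈ J, (F j).indicator (fun _ => 2 * B) x := by
    intro x
    by_cases hx : ∃ j ∈ J, x ∈ F j
    · obtain ⟨j, hj, hxj⟩ := hx
      calc _ ≤ |layerFun p w t ((x - ⟪v, x⟫ • v) + s • v)| +
            |layerFun p w t ((x - ⟪v, x⟫ • v) + s' • v)| := abs_sub _ _
        _ ≤ B + B := add_le_add (hB.abs_layerFun_le w t _) (hB.abs_layerFun_le w t _)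
        _ = (F j).indicator (fun _ => 2 * B) x := by rw [Set.indicator_of_mem hxj]; ring
        _ ≤ _ := Finset.single_le_sum (f := fun j => (F j).indicator (fun _ => 2 * B) x)
            (fun i _ => Set.indicator_nonneg (fun _ _ => by positivity) _) hj
    · push Not at hx
      have : layerFun p w t ((x - ⟪v, x⟫ • v) + s • v) =
          layerFun p w t ((x - ⟪v, x⟫ • v) + s' • v) := by
        apply hJ
        intro j hj
        have := hx j hj
        simpa [hF, firstLayer] using this
      rw [this, sub_self, abs_zero]
      exact Finset.sum_nonneg fun i _ => Set.indicator_nonneg (fun _ _ => by positivity) _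
  have hiF : ∀ j ∈ J, Integrable (fun x => (F j).indicator (fun _ => 2 * B) x) γ := fun j _ =>
    (integrable_const _).indicator (hFm j)
  calc _ = |∫ x, (layerFun p w t ((x - ⟪v, x⟫ • v) + s • v) -
        layerFun p w t ((x - ⟪v, x⟫ • v) + s' • v)) ∂γ| := by
        rw [integral_sub (hint s) (hint s')]
        rfl
    _ ≤ ∫ x, |layerFun p w t ((x - ⟪v, x⟫ • v) + s • v) -
        layerFun p w t ((x - ⟪v, x⟫ • v) + s' • v)| ∂γ := abs_integral_le_integral_abs
    _ ≤ ∫ x, ∑ j ∈ J, (F j).indicator (fun _ => 2 * B) x ∂γ :=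
        integral_mono ((hint s).sub (hint s')).abs (integrable_finsetSum _ hiF) hpt
    _ = ∑ j ∈ J, γ.real (F j) * (2 * B) := by
        rw [integral_finsetSum _ hiF]
        refine Finset.sum_congr rfl fun j _ => ?_
        rw [integral_indicator_const _ (hFm j), smul_eq_mul]
    _ ≤ ∑ j ∈ J, |s - s'| / σ * (2 * B) := by
        gcongr with j hj
        exact measureReal_flip_le hv (hw j) hσ (hvw j hj) t s s'
    _ = J.card * (|s - s'| / σ * (2 * B)) := by rw [Finset.sum_const, nsmul_eq_mul]
    _ ≤ d * (|s - s'| / σ * (2 * B)) := by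
        gcongr
        simpa using Finset.card_le_univ J
    _ = _ := by ring

lemma measurable_condMean {n : ℕ} (v : EuclideanSpace ℝ (Fin n))
    {f : EuclideanSpace ℝ (Fin n) → ℝ} (hf : Measurable f) :
    Measurable fun s => condMeanOnHyperplane v s f := by
  have : StronglyMeasurable (Function.uncurry fun (s : ℝ) (x : EuclideanSpace ℝ (Fin n)) =>
      f ((x - ⟪v, x⟫ • v) + s • v)) := by
    apply Measurable.stronglyMeasurable
    exact hf.comp (by fun_prop)
  exact this.integral_prod_right.measurable

lemma abs_condMean_le {n : ℕ} (v : EuclideanSpace ℝ (Fin n)) (s : ℝ)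
    {f : EuclideanSpace ℝ (Fin n) → ℝ} {B : ℝ} (hB : ∀ x, |f x| ≤ B) :
    |condMeanOnHyperplane v s f| ≤ B := by
  have := norm_integral_le_of_norm_le_const (μ := stdGaussian (EuclideanSpace ℝ (Fin n)))
    (f := fun x => f ((x - ⟪v, x⟫ • v) + s • v)) (C := B)
    (Filter.Eventually.of_forall fun x => hB _)
  simpa [condMeanOnHyperplane] using this

lemma condMean_neg {n : ℕ} (v : EuclideanSpace ℝ (Fin n)) (s : ℝ)
    (f : EuclideanSpace ℝ (Fin n) → ℝ) :
    condMeanOnHyperplane (-v) s f = condMeanOnHyperplane v (-s) f := by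
  simp [condMeanOnHyperplane]

/-- On the hyperplane `w_iᵀ x = s` the `i`-th threshold is constant: it is `1` for `s ≥ t` and `0`
otherwise. -/
lemma condMean_self_eq {n d : ℕ} (p : (Fin d → ℝ) → ℝ) {w : Fin d → EuclideanSpace ℝ (Fin n)}
    {i : Fin d} (hw : ‖w i‖ = 1) (t s : ℝ) :
    condMeanOnHyperplane (w i) s (layerFun p w t) =
      condMeanOnHyperplane (w i) s
        (layerFun (fun X => p (Function.update X i (sgnAct (s - t)))) w t) := by
  unfold condMeanOnHyperplane
  congr 1
  funext x
  unfold layerFun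
  dsimp only
  congr 1
  rw [eq_comm, Function.update_eq_self_iff]
  unfold firstLayer
  rw [inner_self_hyperplanePoint hw]

/-- Upward jump of the conditional mean across the threshold `w_iᵀ x = t`: away from the threshold
the conditional mean is Lipschitz, and at the threshold it increases by the conditional mean of the
discrete derivative of `p`. -/
lemma le_condMean_self_sub {n d : ℕ} {p : (Fin d → ℝ) → ℝ} (hp : Measurable p) {B : ℝ}
    (hB : CubeBound p B) {w : Fin d → EuclideanSpace ℝ (Fin n)} (hw : ∀ j, ‖w j‖ = 1)
    {i : Fin d} {σ : ℝ} (hσ : 0 < σ) (hij : ∀ j, j ≠ i → σ ^ 2 ≤ 1 - ⟪w i, w j⟫ ^ 2)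
    {t ε : ℝ}
    (hjump : ε ≤ condMeanOnHyperplane (w i) t
      (layerFun (fun X => p (Function.update X i 1) - p (Function.update X i 0)) w t))
    {a b : ℝ} (hab : b ≤ a) :
    (if b < t ∧ t ≤ a then ε else 0) - 2 * B * d / σ * (a - b) ≤
      condMeanOnHyperplane (w i) a (layerFun p w t) -
        condMeanOnHyperplane (w i) b (layerFun p w t) := by
  set q : ℝ → (Fin d → ℝ) → ℝ := fun c X => p (Function.update X i c) with hq
  have hqm : ∀ c, Measurable (q c) := fun c => hp.comp (measurable_update_left)
  have hqB : ∀ c, (c = 0 ∨ c = 1) → CubeBound (q c) B := by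
    intro c hc X hX
    apply hB
    intro j
    by_cases hj : j = i
    · subst hj; simpa using hc
    · simpa [hj] using hX j
  have hlip : ∀ c, (c = 0 ∨ c = 1) → ∀ s s', |condMeanOnHyperplane (w i) s (layerFun (q c) w t) -
      condMeanOnHyperplane (w i) s' (layerFun (q c) w t)| ≤ 2 * B * d / σ * |s - s'| := by
    intro c hc s s'
    refine abs_condMean_sub_le (J := Finset.univ.erase i) (hqm c) (hqB c hc) ?_ hw (hw i) hσ ?_
      t s s'
    · intro X Y hXY
      simp only [hq]
      congr 1
      funext j
      by_cases hj : j = i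
      · subst hj; simp
      · simpa [hj] using hXY j (by simp [hj])
    · intro j hj
      exact hij j (Finset.ne_of_mem_erase hj)
  have hK : 0 ≤ 2 * B * d / σ := by have := hB.nonneg; positivity
  have hcase : ∀ s, condMeanOnHyperplane (w i) s (layerFun p w t) =
      condMeanOnHyperplane (w i) s (layerFun (q (sgnAct (s - t))) w t) := fun s =>
    condMean_self_eq p (hw i) t s
  rw [hcase a, hcase b]
  by_cases hbt : b < t
  · by_cases hta : t ≤ a
    · rw [if_pos ⟨hbt, hta⟩]
      have ea : sgnAct (a - t) = 1 := if_pos (by linarith)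
      have eb : sgnAct (b - t) = 0 := if_neg (by linarith)
      rw [ea, eb]
      have hm : Measurable fun x : EuclideanSpace ℝ (Fin n) =>
        (x - ⟪w i, x⟫ • w i) + t • w i := by fun_prop
      have hint : ∀ c, (c = 0 ∨ c = 1) → Integrable (fun x : EuclideanSpace ℝ (Fin n) =>
          layerFun (q c) w t ((x - ⟪w i, x⟫ • w i) + t • w i))
          (stdGaussian (EuclideanSpace ℝ (Fin n))) := fun c hc =>
        Integrable.of_bound ((measurable_layerFun (hqm c) w t).comp hm).aestronglyMeasurable B
          (Filter.Eventually.of_forall fun x => (hqB c hc).abs_layerFun_le w t _)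
      have hj : ε ≤ condMeanOnHyperplane (w i) t (layerFun (q 1) w t) -
          condMeanOnHyperplane (w i) t (layerFun (q 0) w t) := by
        refine hjump.trans_eq ?_
        exact integral_sub (hint 1 (Or.inr rfl)) (hint 0 (Or.inl rfl))
      have h1 := hlip 1 (Or.inr rfl) a t
      have h0 := hlip 0 (Or.inl rfl) t b
      rw [abs_of_nonneg (sub_nonneg.2 hta)] at h1
      rw [abs_of_nonneg (sub_nonneg.2 hbt.le)] at h0
      have h1' := (abs_le.1 h1).1
      have h0' := (abs_le.1 h0).1
      linarith [mul_add (2 * B * d / σ) (a - t) (t - b)]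
    · rw [if_neg (fun h => hta h.2)]
      have ea : sgnAct (a - t) = 0 := if_neg (by linarith)
      have eb : sgnAct (b - t) = 0 := if_neg (by linarith)
      rw [ea, eb]
      have h0 := hlip 0 (Or.inl rfl) a b
      rw [abs_of_nonneg (sub_nonneg.2 hab)] at h0
      linarith [(abs_le.1 h0).1]
  · rw [if_neg (fun h => hbt h.1)]
    have ea : sgnAct (a - t) = 1 := if_pos (by linarith)
    have eb : sgnAct (b - t) = 1 := if_pos (by linarith)
    rw [ea, eb]
    have h0 := hlip 1 (Or.inr rfl) a b
    rw [abs_of_nonneg (sub_nonneg.2 hab)] at h0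
    linarith [(abs_le.1 h0).1]

/-! ### The jump statistic -/

/-- The tent function with support `[0, 2h]` and peak `h` at `h`. -/
noncomputable def tent (h u : ℝ) : ℝ := max 0 (h - |u - h|)

/-- The odd function that is `tent h` on the positive axis. -/
noncomputable def oddTent (h u : ℝ) : ℝ := tent h u - tent h (-u)

lemma tent_nonneg (h u : ℝ) : 0 ≤ tent h u := le_max_left _ _

lemma tent_le {h : ℝ} (hh : 0 ≤ h) (u : ℝ) : tent h u ≤ h :=
  max_le hh (by linarith [abs_nonneg (u - h)])

lemma tent_eq_zero {h u : ℝ} (hu : u ∉ Set.Ioo 0 (2 * h)) : tent h u = 0 := by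
  rw [tent, max_eq_left]
  rw [Set.mem_Ioo, not_and_or, not_lt, not_lt] at hu
  rcases hu with hu | hu
  · linarith [neg_abs_le (u - h)]
  · linarith [le_abs_self (u - h)]

lemma abs_tent_sub_le (h u u' : ℝ) : |tent h u - tent h u'| ≤ |u - u'| := by
  unfold tent
  refine (abs_max_sub_max_le_max _ _ _ _).trans (max_le (by simp) ?_)
  rw [show h - |u - h| - (h - |u' - h|) = |u' - h| - |u - h| by ring, abs_sub_comm u u']
  refine (abs_abs_sub_abs_le_abs_sub _ _).trans_eq ?_
  congr 1
  ring

lemma continuous_tent (h : ℝ) : Continuous (tent h) := by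
  unfold tent
  fun_prop

lemma continuous_oddTent (h : ℝ) : Continuous (oddTent h) :=
  (continuous_tent h).sub ((continuous_tent h).comp continuous_neg)

lemma abs_oddTent_le {h : ℝ} (hh : 0 ≤ h) (u : ℝ) : |oddTent h u| ≤ h := by
  unfold oddTent
  rw [abs_le]
  constructor <;>
    linarith [tent_nonneg h u, tent_nonneg h (-u), tent_le hh u, tent_le hh (-u)]

lemma abs_oddTent_sub_le (h u u' : ℝ) : |oddTent h u - oddTent h u'| ≤ 2 * |u - u'| := by
  unfold oddTent
  have h1 := abs_tent_sub_le h u u'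
  have h2 := abs_tent_sub_le h (-u') (-u)
  rw [show -u' - -u = u - u' by ring] at h2
  calc _ = |(tent h u - tent h u') + (tent h (-u') - tent h (-u))| := by congr 1; ring
    _ ≤ _ := (abs_add_le _ _).trans (by linarith)

lemma integrable_tent (h : ℝ) : Integrable (tent h) := by
  apply (continuous_tent h).integrable_of_hasCompactSupport
  apply HasCompactSupport.intro (isCompact_Icc (a := 0) (b := 2 * h))
  intro u hu
  exact tent_eq_zero fun h' => hu (Set.Ioo_subset_Icc_self h')

lemma sq_div_two_le_integral_tent {h : ℝ} (hh : 0 ≤ h) : h ^ 2 / 2 ≤ ∫ u, tent h u := by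
  -- the tent lies above the box of height `h / 2` over its middle half
  have hle : ∀ u, (Set.Icc (h / 2) (3 * h / 2)).indicator (fun _ => h / 2) u ≤ tent h u := by
    intro u
    by_cases hu : u ∈ Set.Icc (h / 2) (3 * h / 2)
    · rw [Set.indicator_of_mem hu]
      refine le_trans ?_ (le_max_right _ _)
      have : |u - h| ≤ h / 2 := abs_le.2 ⟨by linarith [hu.1], by linarith [hu.2]⟩
      linarith
    · rw [Set.indicator_of_notMem hu]
      exact tent_nonneg h u
  calc h ^ 2 / 2 = ∫ u, (Set.Icc (h / 2) (3 * h / 2)).indicator (fun _ => h / 2) u := by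
        rw [integral_indicator_const _ measurableSet_Icc, Real.volume_real_Icc_of_le (by linarith),
          smul_eq_mul]
        ring
    _ ≤ _ := integral_mono ((integrable_indicator_iff measurableSet_Icc).2
        (integrableOn_const (by simp))) (integrable_tent h) hle

/-- The smoothed, density-weighted jump of the conditional mean `E[f(x) | vᵀ x = s]` at `s = t`,
at scale `h`: the correlation of `f` with an odd bump in `vᵀ x - t`. -/
noncomputable def jumpStat {n : ℕ} (f : EuclideanSpace ℝ (Fin n) → ℝ) (t h : ℝ)
    (v : EuclideanSpace ℝ (Fin n)) : ℝ :=
  ∫ x, f x * oddTent h (⟪v, x⟫ - t) ∂(stdGaussian (EuclideanSpace ℝ (Fin n)))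

/-- The density-weighted conditional mean `φ(s) E[f(x) | vᵀ x = s]`. -/
noncomputable def weightedMean {n : ℕ} (f : EuclideanSpace ℝ (Fin n) → ℝ)
    (v : EuclideanSpace ℝ (Fin n)) (s : ℝ) : ℝ :=
  gaussianPDFReal 0 1 s * condMeanOnHyperplane v s f

section

variable {n : ℕ} {f : EuclideanSpace ℝ (Fin n) → ℝ} {B : ℝ} {v : EuclideanSpace ℝ (Fin n)}

lemma measurable_weightedMean (hf : Measurable f) : Measurable (weightedMean f v) :=
  (measurable_gaussianPDFReal 0 1).mul (measurable_condMean v hf)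

lemma abs_weightedMean_le (hB : ∀ x, |f x| ≤ B) (s : ℝ) : |weightedMean f v s| ≤ B := by
  rw [weightedMean, abs_mul, abs_of_nonneg (gaussianPDFReal_nonneg 0 1 s)]
  calc _ ≤ 1 * B := mul_le_mul (gaussianPDFReal_zero_one_le_one s) (abs_condMean_le v s hB)
        (abs_nonneg _) zero_le_one
    _ = B := one_mul B

lemma integrable_tent_mul_weightedMean (hf : Measurable f) (hB : ∀ x, |f x| ≤ B) (h : ℝ)
    {g : ℝ → ℝ} (hg : Measurable g) : Integrable fun u => tent h u * weightedMean f v (g u) :=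
  (integrable_tent h).mul_bdd (c := B)
    ((measurable_weightedMean hf).comp hg).aestronglyMeasurable
    (Filter.Eventually.of_forall fun u => abs_weightedMean_le hB (g u))

lemma jumpStat_eq_integral (hf : Measurable f) (hB : ∀ x, |f x| ≤ B) (hv : ‖v‖ = 1) (t : ℝ)
    {h : ℝ} (hh : 0 ≤ h) :
    jumpStat f t h v =
      ∫ u, tent h u * (weightedMean f v (t + u) - weightedMean f v (t - u)) := by
  have h1 := integral_stdGaussian_eq_integral_condMean hv hf hB (ρ := fun s => oddTent h (s - t))
    ((continuous_oddTent h).measurable.comp (measurable_id.sub_const t)) (R := h)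
    (fun s => abs_oddTent_le hh _)
  have ip := integrable_tent_mul_weightedMean (v := v) hf hB h (g := fun u => t + u) (by fun_prop)
  have im := integrable_tent_mul_weightedMean (v := v) hf hB h (g := fun u => t - u) (by fun_prop)
  have ip' : Integrable fun s => tent h (s - t) * weightedMean f v s := by
    simpa using ip.comp_sub_right t
  have im' : Integrable fun s => tent h (t - s) * weightedMean f v s := by
    simpa using im.comp_sub_left t
  calc jumpStat f t h v
      = ∫ s, (tent h (s - t) * weightedMean f v s - tent h (t - s) * weightedMean f v s) := by
        refine h1.trans (integral_congr_ae (Filter.Eventually.of_forall fun s => ?_))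
        simp only [oddTent, weightedMean, neg_sub]
        ring
    _ = (∫ s, tent h (s - t) * weightedMean f v s) - ∫ s, tent h (t - s) * weightedMean f v s :=
        integral_sub ip' im'
    _ = (∫ u, tent h u * weightedMean f v (t + u)) - ∫ u, tent h u * weightedMean f v (t - u) := by
        rw [← integral_add_left_eq_self (fun s => tent h (s - t) * weightedMean f v s) t,
          ← integral_sub_left_eq_self (fun s => tent h (t - s) * weightedMean f v s) volume t]
        simp
    _ = _ := by
        rw [← integral_sub ip im]
        simp_rw [mul_sub]

lemma integrable_tent_mul_weightedMean_sub (hf : Measurable f) (hB : ∀ x, |f x| ≤ B) (t h : ℝ) :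
    Integrable fun u => tent h u * (weightedMean f v (t + u) - weightedMean f v (t - u)) := by
  simp_rw [mul_sub]
  exact (integrable_tent_mul_weightedMean hf hB h (by fun_prop)).sub
    (integrable_tent_mul_weightedMean hf hB h (by fun_prop))

lemma jumpStat_le (hf : Measurable f) (hB : ∀ x, |f x| ≤ B) (hv : ‖v‖ = 1) {t h : ℝ}
    (hh : 0 ≤ h) {U : ℝ}
    (hU : ∀ u, 0 < u → u < 2 * h → weightedMean f v (t + u) - weightedMean f v (t - u) ≤ U) :
    jumpStat f t h v ≤ (∫ u, tent h u) * U := by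
  rw [jumpStat_eq_integral hf hB hv t hh, ← integral_mul_const]
  refine integral_mono (integrable_tent_mul_weightedMean_sub hf hB t h)
    ((integrable_tent h).mul_const U) fun u => ?_
  by_cases hu : u ∈ Set.Ioo 0 (2 * h)
  · exact mul_le_mul_of_nonneg_left (hU u hu.1 hu.2) (tent_nonneg h u)
  · simp [tent_eq_zero hu]

lemma le_jumpStat (hf : Measurable f) (hB : ∀ x, |f x| ≤ B) (hv : ‖v‖ = 1) {t h : ℝ}
    (hh : 0 ≤ h) {U : ℝ}
    (hU : ∀ u, 0 < u → u < 2 * h → U ≤ weightedMean f v (t + u) - weightedMean f v (t - u)) :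
    (∫ u, tent h u) * U ≤ jumpStat f t h v := by
  rw [jumpStat_eq_integral hf hB hv t hh, ← integral_mul_const]
  refine integral_mono ((integrable_tent h).mul_const U)
    (integrable_tent_mul_weightedMean_sub hf hB t h) fun u => ?_
  by_cases hu : u ∈ Set.Ioo 0 (2 * h)
  · exact mul_le_mul_of_nonneg_left (hU u hu.1 hu.2) (tent_nonneg h u)
  · simp [tent_eq_zero hu]

/-- The density factor costs only a Lipschitz error. -/
lemma abs_weightedMean_sub_sub_le (hB : ∀ x, |f x| ≤ B) {t u : ℝ} (hu : 0 < u) :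
    |weightedMean f v (t + u) - weightedMean f v (t - u) - gaussianPDFReal 0 1 (t + u) *
      (condMeanOnHyperplane v (t + u) f - condMeanOnHyperplane v (t - u) f)| ≤ 2 * B * u := by
  have h1 : weightedMean f v (t + u) - weightedMean f v (t - u) - gaussianPDFReal 0 1 (t + u) *
      (condMeanOnHyperplane v (t + u) f - condMeanOnHyperplane v (t - u) f) =
      (gaussianPDFReal 0 1 (t + u) - gaussianPDFReal 0 1 (t - u)) *
        condMeanOnHyperplane v (t - u) f := by
    unfold weightedMean
    ring
  have h2 := abs_gaussianPDFReal_sub_le (t + u) (t - u)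
  rw [show t + u - (t - u) = 2 * u by ring, abs_of_pos (by linarith : (0 : ℝ) < 2 * u)] at h2
  rw [h1, abs_mul]
  calc _ ≤ (2 * u) * B :=
        mul_le_mul h2 (abs_condMean_le v _ hB) (abs_nonneg _) (by linarith)
    _ = _ := by ring

/-- If the conditional mean grows at most linearly, the jump statistic is of lower order. -/
lemma jumpStat_le_of_condMean_sub_le (hf : Measurable f) (hB : ∀ x, |f x| ≤ B) (hv : ‖v‖ = 1)
    {t h : ℝ} (hh : 0 ≤ h) {K : ℝ} (hK : 0 ≤ K)
    (hU : ∀ u, 0 < u →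
      condMeanOnHyperplane v (t + u) f - condMeanOnHyperplane v (t - u) f ≤ K * (2 * u)) :
    jumpStat f t h v ≤ (∫ u, tent h u) * (4 * h * (K + B)) := by
  have hB0 : 0 ≤ B := (abs_nonneg _).trans (hB 0)
  refine jumpStat_le hf hB hv hh fun u hu hu2 => ?_
  have h1 := (abs_le.1 (abs_weightedMean_sub_sub_le (v := v) hB (t := t) hu)).2
  have h2 : gaussianPDFReal 0 1 (t + u) *
      (condMeanOnHyperplane v (t + u) f - condMeanOnHyperplane v (t - u) f) ≤ K * (2 * u) :=
    calc _ ≤ gaussianPDFReal 0 1 (t + u) * (K * (2 * u)) :=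
          mul_le_mul_of_nonneg_left (hU u hu) (gaussianPDFReal_nonneg _ _ _)
      _ ≤ 1 * (K * (2 * u)) := by
          gcongr
          exact gaussianPDFReal_zero_one_le_one _
      _ = _ := one_mul _
  have h3 : (K + B) * u ≤ (K + B) * (2 * h) := by gcongr
  linarith

/-- If the conditional mean jumps up by `ε` at height `t`, the jump statistic is large. -/
lemma le_jumpStat_of_le_condMean_sub (hf : Measurable f) (hB : ∀ x, |f x| ≤ B) (hv : ‖v‖ = 1)
    {t h : ℝ} (hh : 0 ≤ h) {K ε : ℝ} (hK : 0 ≤ K) (hε : 0 ≤ ε) (hε1 : ε ≤ 1)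
    (hU : ∀ u, 0 < u → ε - K * (2 * u) ≤
      condMeanOnHyperplane v (t + u) f - condMeanOnHyperplane v (t - u) f) :
    (∫ u, tent h u) * (ε * gaussianPDFReal 0 1 t - 4 * h * (K + B + 1)) ≤ jumpStat f t h v := by
  have hB0 : 0 ≤ B := (abs_nonneg _).trans (hB 0)
  refine le_jumpStat hf hB hv hh fun u hu hu2 => ?_
  have h1 := (abs_le.1 (abs_weightedMean_sub_sub_le (v := v) hB (t := t) hu)).1
  have hφ := (abs_le.1 (abs_gaussianPDFReal_sub_le (t + u) t)).1
  rw [add_sub_cancel_left, abs_of_pos hu] at hφ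
  have h2 : ε * gaussianPDFReal 0 1 t - u - K * (2 * u) ≤ gaussianPDFReal 0 1 (t + u) *
      (condMeanOnHyperplane v (t + u) f - condMeanOnHyperplane v (t - u) f) :=
    calc _ ≤ ε * gaussianPDFReal 0 1 (t + u) - K * (2 * u) := by
          have : ε * (gaussianPDFReal 0 1 t - u) ≤ ε * gaussianPDFReal 0 1 (t + u) :=
            mul_le_mul_of_nonneg_left (by linarith) hε
          have : ε * u ≤ 1 * u := by gcongr
          linarith
      _ ≤ gaussianPDFReal 0 1 (t + u) * (ε - K * (2 * u)) := by
          have : gaussianPDFReal 0 1 (t + u) * (K * (2 * u)) ≤ 1 * (K * (2 * u)) := by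
            gcongr
            exact gaussianPDFReal_zero_one_le_one _
          linarith
      _ ≤ _ := mul_le_mul_of_nonneg_left (hU u hu) (gaussianPDFReal_nonneg _ _ _)
  have h3 : (K + B + 1) * u ≤ (K + B + 1) * (2 * h) := by gcongr
  linarith

lemma integrable_inner_stdGaussian (a : EuclideanSpace ℝ (Fin n)) :
    Integrable (fun x => ⟪a, x⟫) (stdGaussian (EuclideanSpace ℝ (Fin n))) :=
  (innerSL ℝ a).integrable_comp IsGaussian.integrable_id

lemma integral_abs_inner_stdGaussian_le (a : EuclideanSpace ℝ (Fin n)) :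
    ∫ x, |⟪a, x⟫| ∂(stdGaussian (EuclideanSpace ℝ (Fin n))) ≤ ‖a‖ := by
  set γ := stdGaussian (EuclideanSpace ℝ (Fin n))
  have hL : MemLp (fun x : EuclideanSpace ℝ (Fin n) => ⟪a, x⟫) 2 γ :=
    (IsGaussian.hasGaussianLaw_id.map_fun (innerSL ℝ a)).memLp_two
  have h2 : ∫ x, ⟪a, x⟫ ^ 2 ∂γ = ‖a‖ ^ 2 := by
    have hz : γ[fun x => ⟪a, x⟫] = 0 := integral_strongDual_stdGaussian (innerSL ℝ a)
    have := variance_dual_stdGaussian (innerSL ℝ a)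
    rw [innerSL_apply_norm] at this
    rw [← this]
    exact (variance_of_integral_eq_zero hL.aestronglyMeasurable.aemeasurable hz).symm
  -- the second moment dominates the square of the first
  have h3 : 0 ≤ Var[fun x => |⟪a, x⟫|; γ] := variance_nonneg _ _
  have hA : MemLp (fun x : EuclideanSpace ℝ (Fin n) => |⟪a, x⟫|) 2 γ := hL.abs
  rw [variance_eq_sub hA] at h3
  have h4 : γ[(fun x : EuclideanSpace ℝ (Fin n) => |⟪a, x⟫|) ^ 2] = ‖a‖ ^ 2 := by
    rw [← h2]
    simp
  rw [h4] at h3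
  exact le_of_sq_le_sq (by linarith) (norm_nonneg a)

lemma abs_jumpStat_sub_le (hf : Measurable f) (hB : ∀ x, |f x| ≤ B) {t h : ℝ} (hh : 0 ≤ h)
    (v v' : EuclideanSpace ℝ (Fin n)) :
    |jumpStat f t h v - jumpStat f t h v'| ≤ 2 * B * ‖v - v'‖ := by
  set γ := stdGaussian (EuclideanSpace ℝ (Fin n))
  have hB0 : 0 ≤ B := (abs_nonneg _).trans (hB 0)
  have hint : ∀ a : EuclideanSpace ℝ (Fin n),
      Integrable (fun x => f x * oddTent h (⟪a, x⟫ - t)) γ := fun a =>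
    Integrable.of_bound (C := B * h) (hf.mul ((continuous_oddTent h).measurable.comp
      (by fun_prop))).aestronglyMeasurable (Filter.Eventually.of_forall fun x => by
        rw [Real.norm_eq_abs, abs_mul]
        exact mul_le_mul (hB x) (abs_oddTent_le hh _) (abs_nonneg _) hB0)
  calc _ = |∫ x, (f x * oddTent h (⟪v, x⟫ - t) - f x * oddTent h (⟪v', x⟫ - t)) ∂γ| := by
        rw [integral_sub (hint v) (hint v')]
        rfl
    _ ≤ ∫ x, |f x * oddTent h (⟪v, x⟫ - t) - f x * oddTent h (⟪v', x⟫ - t)| ∂γ :=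
        abs_integral_le_integral_abs
    _ ≤ ∫ x, 2 * B * |⟪v - v', x⟫| ∂γ := by
        refine integral_mono ((hint v).sub (hint v')).abs
          ((integrable_inner_stdGaussian _).abs.const_mul _) fun x => ?_
        dsimp only
        rw [← mul_sub, abs_mul, inner_sub_left]
        have := abs_oddTent_sub_le h (⟪v, x⟫ - t) (⟪v', x⟫ - t)
        rw [sub_sub_sub_cancel_right] at this
        calc _ ≤ B * (2 * |⟪v, x⟫ - ⟪v', x⟫|) := mul_le_mul (hB x) this (abs_nonneg _) hB0
          _ = _ := by ring
    _ ≤ 2 * B * ‖v - v'‖ := by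
        rw [integral_const_mul]
        gcongr
        exact integral_abs_inner_stdGaussian_le _

end

/-! ### The jump statistic detects the weight vectors -/

lemma norm_sub_sq_of_unit {n : ℕ} {v w : EuclideanSpace ℝ (Fin n)} (hv : ‖v‖ = 1) (hw : ‖w‖ = 1) :
    ‖v - w‖ ^ 2 = 2 - 2 * ⟪v, w⟫ := by
  rw [norm_sub_sq_real, hv, hw]
  ring

lemma norm_add_sq_of_unit {n : ℕ} {v w : EuclideanSpace ℝ (Fin n)} (hv : ‖v‖ = 1) (hw : ‖w‖ = 1) :
    ‖v + w‖ ^ 2 = 2 + 2 * ⟪v, w⟫ := by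
  rw [norm_add_sq_real, hv, hw]
  ring

/-- If a unit vector `v` is `η`-far from both `w` and `-w`, the squared sine of the angle between
them is at least `η² / 2`. -/
lemma le_one_sub_inner_sq {n : ℕ} {v w : EuclideanSpace ℝ (Fin n)} (hv : ‖v‖ = 1) (hw : ‖w‖ = 1)
    {η : ℝ} (hη : 0 ≤ η) (h1 : η ≤ ‖v - w‖) (h2 : η ≤ ‖v + w‖) :
    η ^ 2 / 2 ≤ 1 - ⟪v, w⟫ ^ 2 := by
  have e1 := norm_sub_sq_of_unit hv hw
  have e2 := norm_add_sq_of_unit hv hw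
  have s1 : η ^ 2 ≤ ‖v - w‖ ^ 2 := by gcongr
  have s2 : η ^ 2 ≤ ‖v + w‖ ^ 2 := by gcongr
  rcases le_total 0 (⟪v, w⟫ : ℝ) with h | h <;> nlinarith

lemma le_norm_sub_of_le_one_sub_inner_sq {n : ℕ} {v w : EuclideanSpace ℝ (Fin n)} (hv : ‖v‖ = 1)
    (hw : ‖w‖ = 1) {σ : ℝ} (h : σ ^ 2 ≤ 1 - ⟪v, w⟫ ^ 2) : σ ≤ ‖v - w‖ := by
  apply le_of_sq_le_sq _ (norm_nonneg _)
  rw [norm_sub_sq_of_unit hv hw]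
  nlinarith [sq_nonneg (⟪v, w⟫ - 1)]

/-- The assumptions on `(p, w, t)` with all parameters measured by a single size `Z`. The field
`separated` bounds the squared sine of the angle between `w i` and `w j`, and `jump` is stated with
the discrete derivative of `p` in the `i`-th variable. -/
structure Regular {n d : ℕ} (Z : ℝ) (p : (Fin d → ℝ) → ℝ) (w : Fin d → EuclideanSpace ℝ (Fin n))
    (t : ℝ) : Prop where
  two_le : 2 ≤ Z
  card_le : (d : ℝ) ≤ Z
  measurable : Measurable p
  bound : CubeBound p Z
  norm_eq_one : ∀ i, ‖w i‖ = 1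
  separated : ∀ i j, i ≠ j → (1 / Z ^ 2) ^ 2 ≤ 1 - ⟪w i, w j⟫ ^ 2
  density : 1 / Z ≤ gaussianPDFReal 0 1 t
  jump : ∀ i, 1 / Z ≤ condMeanOnHyperplane (w i) t
    (layerFun (fun X => p (Function.update X i 1) - p (Function.update X i 0)) w t)

namespace Regular

variable {n d : ℕ} {Z : ℝ} {p : (Fin d → ℝ) → ℝ} {w : Fin d → EuclideanSpace ℝ (Fin n)} {t : ℝ}

/-- Since `Z ≥ 2`, the Lipschitz constant that belongs to the sine bound `σ = Z⁻ᵏ` is, with all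
numerical factors, at most a power of `Z`. -/
lemma lipschitz_const_le (R : Regular Z p w t) {k : ℕ} :
    4 * (2 * Z * d / (1 / Z ^ k) + Z + 1) ≤ Z ^ (k + 6) := by
  have hZ := R.two_le
  have hk : 1 ≤ Z ^ k := one_le_pow₀ (by linarith)
  have h1 : 2 * Z * d / (1 / Z ^ k) ≤ 2 * Z * Z * Z ^ k := by
    rw [div_div_eq_mul_div, div_one]
    gcongr
    exact R.card_le
  have h2 : Z + 1 ≤ 2 * Z * Z * Z ^ k := by
    calc Z + 1 ≤ 2 * Z * Z * 1 := by nlinarith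
      _ ≤ _ := by gcongr
  have h3 : 4 * (2 * Z * Z * Z ^ k + 2 * Z * Z * Z ^ k) ≤ Z ^ (k + 6) := by
    have : 16 ≤ Z ^ 4 := by
      calc (16 : ℝ) = 2 ^ 4 := by norm_num
        _ ≤ Z ^ 4 := by gcongr
    calc _ = 16 * (Z ^ 2 * Z ^ k) := by ring
      _ ≤ Z ^ 4 * (Z ^ 2 * Z ^ k) := by gcongr
      _ = _ := by ring
  linarith

lemma inv_pow_four_le (hZ : 2 ≤ Z) : 1 / Z ^ 4 ≤ 1 / Z ^ 2 / 4 := by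
  rw [div_div, one_div_le_one_div (by positivity) (by positivity)]
  calc Z ^ 2 * 4 = Z ^ 2 * 2 ^ 2 := by norm_num
    _ ≤ Z ^ 2 * Z ^ 2 := by gcongr
    _ = Z ^ 4 := by ring

lemma integral_tent_nonneg (h : ℝ) : 0 ≤ ∫ u, tent h u := integral_nonneg (tent_nonneg h)

/-- In the direction `-w_i` the conditional mean grows at most linearly: reversing the direction
turns the upward jump at the threshold into a downward jump. -/
lemma condMean_neg_sub_le (R : Regular Z p w t) (i : Fin d) {u : ℝ} (hu : 0 < u) :
    condMeanOnHyperplane (-w i) (t + u) (layerFun p w t) -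
      condMeanOnHyperplane (-w i) (t - u) (layerFun p w t) ≤
        2 * Z * d / (1 / Z ^ 2) * (2 * u) := by
  have hZ := R.two_le
  rw [condMean_neg, condMean_neg]
  have h := le_condMean_self_sub R.measurable R.bound R.norm_eq_one (i := i) (σ := 1 / Z ^ 2)
    (by positivity) (fun j hj => R.separated i j hj.symm) (R.jump i)
    (a := -(t - u)) (b := -(t + u)) (by linarith)
  have h0 : (0 : ℝ) ≤ if -(t + u) < t ∧ t ≤ -(t - u) then 1 / Z else 0 := by
    split_ifs
    · positivity
    · exact le_rfl
  rw [show -(t - u) - -(t + u) = 2 * u by ring] at h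
  linarith

lemma le_jumpStat_self (R : Regular Z p w t) (i : Fin d) {h : ℝ} (hh : 0 ≤ h)
    (hh2 : h ≤ 1 / Z ^ 12) :
    (∫ u, tent h u) * (1 / Z ^ 2 * (3 / 4)) ≤ jumpStat (layerFun p w t) t h (w i) := by
  have hZ := R.two_le
  have hB0 := R.bound.nonneg
  refine le_trans ?_ (le_jumpStat_of_le_condMean_sub (measurable_layerFun R.measurable w t)
    (R.bound.abs_layerFun_le w t) (R.norm_eq_one i) hh (K := 2 * Z * d / (1 / Z ^ 2))
    (ε := 1 / Z) (by positivity) (by positivity) ?_ ?_)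
  · gcongr
    · exact integral_tent_nonneg h
    have h1 : 1 / Z ^ 2 ≤ 1 / Z * gaussianPDFReal 0 1 t :=
      calc 1 / Z ^ 2 = 1 / Z * (1 / Z) := by rw [div_mul_div_comm, one_mul, sq]
        _ ≤ _ := by
          gcongr
          exact R.density
    have h2 : 4 * h * (2 * Z * d / (1 / Z ^ 2) + Z + 1) ≤ 1 / Z ^ 4 :=
      calc _ = h * (4 * (2 * Z * d / (1 / Z ^ 2) + Z + 1)) := by ring
        _ ≤ 1 / Z ^ 12 * Z ^ (2 + 6) := by
          gcongr
          exact R.lipschitz_const_le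
        _ = _ := by field_simp
    have h3 := inv_pow_four_le hZ
    linarith
  · rw [div_le_one (by linarith)]
    linarith
  · intro u hu
    have h := le_condMean_self_sub R.measurable R.bound R.norm_eq_one (i := i) (σ := 1 / Z ^ 2)
      (by positivity) (fun j hj => R.separated i j hj.symm) (R.jump i)
      (a := t + u) (b := t - u) (by linarith)
    rw [if_pos ⟨by linarith, by linarith⟩, show t + u - (t - u) = 2 * u by ring] at h
    exact h

lemma jumpStat_neg_le (R : Regular Z p w t) (i : Fin d) {h : ℝ} (hh : 0 ≤ h)
    (hh2 : h ≤ 1 / Z ^ 12) :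
    jumpStat (layerFun p w t) t h (-w i) ≤ (∫ u, tent h u) * (1 / Z ^ 2 * (1 / 4)) := by
  have hZ := R.two_le
  have hB0 := R.bound.nonneg
  refine (jumpStat_le_of_condMean_sub_le (measurable_layerFun R.measurable w t)
    (R.bound.abs_layerFun_le w t) (by rw [norm_neg]; exact R.norm_eq_one i) hh
    (K := 2 * Z * d / (1 / Z ^ 2)) (by positivity)
    (fun u hu => R.condMean_neg_sub_le i hu)).trans ?_
  refine mul_le_mul_of_nonneg_left ?_ (integral_tent_nonneg h)
  have h2 : 4 * h * (2 * Z * d / (1 / Z ^ 2) + Z) ≤ 1 / Z ^ 4 :=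
      calc _ = h * (4 * (2 * Z * d / (1 / Z ^ 2) + Z)) := by ring
        _ ≤ 1 / Z ^ 12 * Z ^ (2 + 6) := by
          gcongr
          exact le_trans (by linarith) (R.lipschitz_const_le (k := 2))
        _ = _ := by field_simp
  linarith [inv_pow_four_le hZ]

/-- The scale `Z⁻⁴³` is fine enough for directions that are `Z⁻³²`-far from all lines: there the
Lipschitz constant is at most of order `Z³⁹`. -/
lemma jumpStat_le_of_far (R : Regular Z p w t) {v : EuclideanSpace ℝ (Fin n)} (hv : ‖v‖ = 1)
    (hfar : ∀ j, 1 / Z ^ 32 ≤ ‖v - w j‖ ∧ 1 / Z ^ 32 ≤ ‖v + w j‖) :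
    jumpStat (layerFun p w t) t (1 / Z ^ 43) v ≤
      (∫ u, tent (1 / Z ^ 43) u) * (1 / Z ^ 2 * (1 / 4)) := by
  have hZ := R.two_le
  have hB0 := R.bound.nonneg
  have hσ : ∀ j, (1 / Z ^ 33) ^ 2 ≤ 1 - ⟪v, w j⟫ ^ 2 := by
    intro j
    refine le_trans ?_ (le_one_sub_inner_sq hv (R.norm_eq_one j) (by positivity)
      (hfar j).1 (hfar j).2)
    rw [div_pow, div_pow, one_pow, div_div, one_div_le_one_div (by positivity) (by positivity)]
    calc (Z ^ 32) ^ 2 * 2 ≤ (Z ^ 32) ^ 2 * Z ^ 2 := by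
          gcongr
          nlinarith
      _ = _ := by ring
  refine (jumpStat_le_of_condMean_sub_le (measurable_layerFun R.measurable w t)
    (R.bound.abs_layerFun_le w t) hv (by positivity)
    (K := 2 * Z * d / (1 / Z ^ 33)) (by positivity) ?_).trans ?_
  · intro u hu
    have h := abs_condMean_sub_le R.measurable R.bound (J := Finset.univ)
      (fun X Y h => congrArg p (funext fun j => h j (Finset.mem_univ j)))
      R.norm_eq_one hv (σ := 1 / Z ^ 33) (by positivity) (fun j _ => hσ j) t (t + u) (t - u)
    rw [show t + u - (t - u) = 2 * u by ring, abs_of_pos (by linarith : (0 : ℝ) < 2 * u)] at h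
    exact (abs_le.1 h).2
  · refine mul_le_mul_of_nonneg_left ?_ (integral_tent_nonneg _)
    have h2 : 4 * (1 / Z ^ 43) * (2 * Z * d / (1 / Z ^ 33) + Z) ≤ 1 / Z ^ 4 :=
      calc _ = 1 / Z ^ 43 * (4 * (2 * Z * d / (1 / Z ^ 33) + Z)) := by ring
        _ ≤ 1 / Z ^ 43 * Z ^ (33 + 6) := by
          gcongr
          exact le_trans (by linarith) (R.lipschitz_const_le (k := 33))
        _ = _ := by field_simp
    linarith [inv_pow_four_le hZ]

/-- The mass of the tent at scale `Z⁻ᵏ`, in the form in which it is compared with errors. -/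
lemma le_integral_tent_mul (hZ : 2 ≤ Z) (k : ℕ) :
    1 / Z ^ (2 * k + 6) ≤ (∫ u, tent (1 / Z ^ k) u) * (1 / Z ^ 2 * (1 / 8)) := by
  have h1 := sq_div_two_le_integral_tent (h := 1 / Z ^ k) (by positivity)
  calc 1 / Z ^ (2 * k + 6) ≤ (1 / Z ^ k) ^ 2 / 2 * (1 / Z ^ 2 * (1 / 8)) := by
        have : (1 / Z ^ k) ^ 2 / 2 * (1 / Z ^ 2 * (1 / 8)) = 1 / (Z ^ (2 * k + 2) * 16) := by
          rw [div_pow, one_pow, ← pow_mul, mul_comm k 2, pow_add]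
          field_simp
          norm_num
        rw [this, one_div_le_one_div (by positivity) (by positivity)]
        calc Z ^ (2 * k + 2) * 16 = Z ^ (2 * k + 2) * 2 ^ 4 := by norm_num
          _ ≤ Z ^ (2 * k + 2) * Z ^ 4 := by gcongr
          _ = _ := by ring
    _ ≤ _ := by gcongr

/-- A direction whose jump statistic is large at both scales is close to one of the `w_j`. The fine
scale excludes directions far from all lines `ℝ w_j`, the coarse scale those near some `-w_j`. -/
lemma exists_norm_sub_lt (R : Regular Z p w t) {v : EuclideanSpace ℝ (Fin n)} (hv : ‖v‖ = 1)
    (h1 : (∫ u, tent (1 / Z ^ 43) u) * (1 / Z ^ 2 * (3 / 8)) ≤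
      jumpStat (layerFun p w t) t (1 / Z ^ 43) v)
    (h2 : (∫ u, tent (1 / Z ^ 12) u) * (1 / Z ^ 2 * (3 / 8)) ≤
      jumpStat (layerFun p w t) t (1 / Z ^ 12) v) :
    ∃ j, ‖v - w j‖ < 1 / Z ^ 32 := by
  have hZ := R.two_le
  by_contra! hcon
  have hpos : ∀ k : ℕ, 0 < (∫ u, tent (1 / Z ^ k) u) * (1 / Z ^ 2 * (1 / 8)) := fun k =>
    lt_of_lt_of_le (by positivity) (le_integral_tent_mul hZ k)
  by_cases hn : ∀ j, 1 / Z ^ 32 ≤ ‖v + w j‖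
  · have := R.jumpStat_le_of_far hv fun j => ⟨hcon j, hn j⟩
    linarith [hpos 43]
  · push Not at hn
    obtain ⟨j, hj⟩ := hn
    have hneg := R.jumpStat_neg_le j (h := 1 / Z ^ 12) (by positivity) le_rfl
    have hL := (abs_le.1 (abs_jumpStat_sub_le (measurable_layerFun R.measurable w t)
      (R.bound.abs_layerFun_le w t) (t := t) (h := 1 / Z ^ 12) (by positivity) v (-w j))).2
    rw [sub_neg_eq_add] at hL
    have hs : 2 * Z * ‖v + w j‖ < 1 / Z ^ (2 * 12 + 6) := by
      calc 2 * Z * ‖v + w j‖ < 2 * Z * (1 / Z ^ 32) := by gcongr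
        _ ≤ Z * Z * (1 / Z ^ 32) := by gcongr
        _ = _ := by field_simp
    linarith [le_integral_tent_mul hZ 12]

lemma norm_sub_ge (R : Regular Z p w t) {i j : Fin d} (hij : i ≠ j) : 1 / Z ^ 2 ≤ ‖w i - w j‖ :=
  le_norm_sub_of_le_one_sub_inner_sq (R.norm_eq_one i) (R.norm_eq_one j) (R.separated i j hij)

end Regular

/-! ### Uniform concentration of empirical means -/

/-- The empirical mean of `g` on a sample of size `m`. -/
noncomputable def empMean {α : Type*} {m : ℕ} (g : α → ℝ) (x : Fin m → α) : ℝ :=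
  (∑ j, g (x j)) / m

lemma measureReal_sum_sub_integral_ge_le {α : Type*} [MeasurableSpace α] (μ : Measure α)
    [IsProbabilityMeasure μ] {g : α → ℝ} (hg : Measurable g) {R : ℝ} (hR : ∀ x, |g x| ≤ R)
    {m : ℕ} (hm : 0 < m) {a : ℝ} (ha : 0 ≤ a) :
    (Measure.pi fun _ : Fin m => μ).real {x | a ≤ empMean g x - ∫ y, g y ∂μ} ≤
      Real.exp (-(m * a ^ 2 / (2 * R ^ 2))) := by
  have hR0 : 0 ≤ R := by
    obtain ⟨x⟩ := nonempty_of_isProbabilityMeasure μ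
    exact (abs_nonneg _).trans (hR x)
  set π := Measure.pi fun _ : Fin m => μ with hπ
  have hm0 : (0 : ℝ) < m := by exact_mod_cast hm
  have hsub1 : HasSubgaussianMGF (fun y => g y - ∫ y, g y ∂μ) ((‖R - -R‖₊ / 2) ^ 2) μ :=
    hasSubgaussianMGF_of_mem_Icc hg.aemeasurable
      (Filter.Eventually.of_forall fun x => abs_le.1 (hR x))
  have hind : iIndepFun (fun (j : Fin m) (x : Fin m → α) => g (x j) - ∫ y, g y ∂μ) π :=
    iIndepFun_pi (μ := fun _ : Fin m => μ)
      (X := fun (_ : Fin m) (y : α) => g y - ∫ y, g y ∂μ) fun _ => (hg.sub_const _).aemeasurable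
  have hsub : ∀ j ∈ (Finset.univ : Finset (Fin m)),
      HasSubgaussianMGF (fun x : Fin m → α => g (x j) - ∫ y, g y ∂μ) ((‖R - -R‖₊ / 2) ^ 2) π := by
    intro j _
    have hmap : π.map (fun x => x j) = μ := (measurePreserving_eval _ j).map_eq
    refine HasSubgaussianMGF.of_map (X := fun y : α => g y - ∫ y, g y ∂μ)
      (Y := fun x : Fin m → α => x j) (measurable_pi_apply j).aemeasurable ?_
    rw [hmap]
    exact hsub1
  have key := HasSubgaussianMGF.measure_sum_ge_le_of_iIndepFun hind hsub
    (ε := m * a) (by positivity)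
  have hset : {x : Fin m → α | a ≤ empMean g x - ∫ y, g y ∂μ} =
      {x | m * a ≤ ∑ j, (g (x j) - ∫ y, g y ∂μ)} := by
    ext x
    simp only [Set.mem_ofPred_eq, empMean, Finset.sum_sub_distrib, Finset.sum_const,
      Finset.card_univ, Fintype.card_fin, nsmul_eq_mul]
    rw [le_sub_iff_add_le, le_div_iff₀ hm0, le_sub_iff_add_le]
    ring_nf
  rw [hset]
  refine key.trans_eq ?_
  congr 1
  have hc : ((∑ _j : Fin m, (‖R - -R‖₊ / 2) ^ 2 : NNReal) : ℝ) = m * R ^ 2 := by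
    simp only [Finset.sum_const, Finset.card_univ, Fintype.card_fin, nsmul_eq_mul]
    push_cast
    rw [sub_neg_eq_add, Real.norm_eq_abs, abs_of_nonneg (by linarith)]
    ring
  rw [hc]
  by_cases hRz : R = 0
  · simp [hRz]
  · field_simp

/-- Hoeffding's inequality with a union bound over a finite family of bounded functions. -/
lemma measureReal_exists_abs_empMean_sub_ge_le {α κ : Type*} [MeasurableSpace α] [Fintype κ]
    (μ : Measure α) [IsProbabilityMeasure μ] {g : κ → α → ℝ} (hg : ∀ k, Measurable (g k)) {R : ℝ}
    (hR : ∀ k x, |g k x| ≤ R) {m : ℕ} (hm : 0 < m) {a : ℝ} (ha : 0 ≤ a) :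
    (Measure.pi fun _ : Fin m => μ).real {x | ∃ k, a ≤ |empMean (g k) x - ∫ y, g k y ∂μ|} ≤
      Fintype.card κ * (2 * Real.exp (-(m * a ^ 2 / (2 * R ^ 2)))) := by
  set π := Measure.pi fun _ : Fin m => μ with hπ
  have hone : ∀ k, π.real {x | a ≤ |empMean (g k) x - ∫ y, g k y ∂μ|} ≤
      2 * Real.exp (-(m * a ^ 2 / (2 * R ^ 2))) := by
    intro k
    have h1 := measureReal_sum_sub_integral_ge_le μ (hg k) (hR k) hm ha
    have h2 := measureReal_sum_sub_integral_ge_le μ (g := fun y => -g k y) (hg k).neg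
      (by simpa using hR k) hm ha
    have hsub : {x : Fin m → α | a ≤ |empMean (g k) x - ∫ y, g k y ∂μ|} ⊆
        {x | a ≤ empMean (g k) x - ∫ y, g k y ∂μ} ∪
          {x | a ≤ empMean (fun y => -g k y) x - ∫ y, -g k y ∂μ} := by
      intro x hx
      rw [Set.mem_ofPred_eq, le_abs] at hx
      rcases hx with hx | hx
      · exact Or.inl hx
      · refine Or.inr ?_
        rw [Set.mem_ofPred_eq, integral_neg]
        simp only [empMean, Finset.sum_neg_distrib] at hx ⊢
        linarith [neg_div (m : ℝ) (∑ j, g k (x j))]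
    calc _ ≤ _ := measureReal_mono hsub
      _ ≤ _ := measureReal_union_le _ _
      _ ≤ _ := by linarith
  have hset : {x : Fin m → α | ∃ k, a ≤ |empMean (g k) x - ∫ y, g k y ∂μ|} =
      ⋃ k ∈ (Finset.univ : Finset κ), {x | a ≤ |empMean (g k) x - ∫ y, g k y ∂μ|} := by
    ext x
    simp
  rw [hset]
  calc _ ≤ ∑ k : κ, π.real {x | a ≤ |empMean (g k) x - ∫ y, g k y ∂μ|} :=
        measureReal_biUnion_finset_le _ _
    _ ≤ ∑ _k : κ, 2 * Real.exp (-(m * a ^ 2 / (2 * R ^ 2))) := Finset.sum_le_sum fun k _ => hone k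
    _ = _ := by rw [Finset.sum_const, nsmul_eq_mul, Finset.card_univ]

/-! ### A finite net of the sphere -/

lemma norm_le_card_mul_of_abs_le {n : ℕ} {x : EuclideanSpace ℝ (Fin n)} {ρ : ℝ}
    (hx : ∀ i, |x i| ≤ ρ) : ‖x‖ ≤ n * ρ := by
  calc ‖x‖ = ‖∑ i, EuclideanSpace.single i (x i)‖ := by
        congr 1
        ext j
        simp [Finset.sum_apply]
    _ ≤ ∑ i, ‖EuclideanSpace.single i (x i)‖ := norm_sum_le _ _
    _ ≤ ∑ _i : Fin n, ρ := Finset.sum_le_sum fun i _ => by simpa using hx i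
    _ = n * ρ := by simp

lemma norm_normalize_sub_le {n : ℕ} {p w : EuclideanSpace ℝ (Fin n)} (hw : ‖w‖ = 1)
    (hp : p ≠ 0) : ‖(‖p‖⁻¹ • p) - w‖ ≤ 2 * ‖p - w‖ := by
  have hp0 : 0 < ‖p‖ := norm_pos_iff.2 hp
  have h1 : ‖(‖p‖⁻¹ • p) - p‖ ≤ ‖p - w‖ := by
    have e : (‖p‖⁻¹ • p) - p = (‖p‖⁻¹ - 1) • p := by rw [sub_smul, one_smul]
    rw [e, norm_smul, Real.norm_eq_abs, ← abs_of_pos hp0, ← abs_mul, abs_of_pos hp0, sub_mul,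
      inv_mul_cancel₀ hp0.ne', one_mul, ← hw, abs_sub_comm]
    exact abs_norm_sub_norm_le _ _
  calc _ = ‖((‖p‖⁻¹ • p) - p) + (p - w)‖ := by congr 1; abel
    _ ≤ _ := (norm_add_le _ _).trans (by linarith)

/-- The normalized points of the grid `(M⁻¹ ℤ)ⁿ ∩ [-1, 1]ⁿ`; the origin stays at the origin. -/
noncomputable def sphereGrid (n M : ℕ) (k : Fin n → Fin (2 * M + 1)) : EuclideanSpace ℝ (Fin n) :=
  let p : EuclideanSpace ℝ (Fin n) := WithLp.toLp 2 fun i => ((k i : ℝ) - M) / M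
  ‖p‖⁻¹ • p

lemma exists_sphereGrid_near {n M : ℕ} (hM : n < M) {w : EuclideanSpace ℝ (Fin n)}
    (hw : ‖w‖ = 1) :
    ∃ k, ‖sphereGrid n M k‖ = 1 ∧ ‖sphereGrid n M k - w‖ ≤ 2 * n / M := by
  have hM0 : (0 : ℝ) < M := by exact_mod_cast (Nat.zero_le n).trans_lt hM
  have hwi : ∀ i, |w i| ≤ 1 := fun i => by
    have := PiLp.norm_apply_le w i
    rwa [hw, Real.norm_eq_abs] at this
  have hnn : ∀ i, 0 ≤ M * (w i + 1) := fun i => by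
    have := (abs_le.1 (hwi i)).1
    exact mul_nonneg hM0.le (by linarith)
  have hlt : ∀ i, ⌊M * (w i + 1)⌋₊ < 2 * M + 1 := by
    intro i
    rw [Nat.floor_lt (hnn i)]
    push_cast
    have := (abs_le.1 (hwi i)).2
    nlinarith
  set k : Fin n → Fin (2 * M + 1) := fun i => ⟨⌊M * (w i + 1)⌋₊, hlt i⟩ with hk
  set p : EuclideanSpace ℝ (Fin n) := WithLp.toLp 2 fun i => ((k i : ℝ) - M) / M with hp
  have hcoord : ∀ i, |(p - w) i| ≤ 1 / M := by
    intro i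
    have e : (p - w) i = -((M * (w i + 1) - ⌊M * (w i + 1)⌋₊) / M) := by
      simp only [hp, hk, PiLp.sub_apply]
      field_simp
      ring
    have h1 := Nat.floor_le (hnn i)
    have h2 := Nat.lt_floor_add_one (M * (w i + 1))
    rw [e, abs_neg, abs_of_nonneg (div_nonneg (by linarith) hM0.le)]
    gcongr
    linarith
  have hpw : ‖p - w‖ ≤ n * (1 / M) := norm_le_card_mul_of_abs_le hcoord
  have hp0 : p ≠ 0 := by
    intro h0
    rw [h0, zero_sub, norm_neg, hw, mul_one_div, le_div_iff₀ hM0, one_mul] at hpw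
    exact absurd (by exact_mod_cast hpw) (not_le.2 hM)
  refine ⟨k, ?_, ?_⟩
  · change ‖‖p‖⁻¹ • p‖ = 1
    rw [norm_smul, norm_inv, norm_norm, inv_mul_cancel₀ (norm_ne_zero_iff.2 hp0)]
  · change ‖‖p‖⁻¹ • p - w‖ ≤ _
    calc _ ≤ 2 * ‖p - w‖ := norm_normalize_sub_le hw hp0
      _ ≤ 2 * (n * (1 / M)) := by gcongr
      _ = _ := by ring

/-! ### The estimator -/

/-- The empirical jump statistic of a labelled sample. -/
noncomputable def empJumpStat {n m : ℕ} (t h : ℝ) (v : EuclideanSpace ℝ (Fin n))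
    (z : Fin m → EuclideanSpace ℝ (Fin n) × ℝ) : ℝ :=
  empMean (fun y => y.2 * oddTent h (⟪v, y.1⟫ - t)) z

lemma measurable_empJumpStat {n m : ℕ} (t h : ℝ) (v : EuclideanSpace ℝ (Fin n)) :
    Measurable (empJumpStat (m := m) t h v) := by
  unfold empJumpStat empMean
  refine (Finset.measurable_fun_sum _ fun j _ => ?_).div_const _
  have h1 : Measurable fun z : Fin m → EuclideanSpace ℝ (Fin n) × ℝ => (z j).2 :=
    measurable_snd.comp (measurable_pi_apply j)
  have h2 : Measurable fun z : Fin m → EuclideanSpace ℝ (Fin n) × ℝ => (z j).1 :=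
    measurable_fst.comp (measurable_pi_apply j)
  exact h1.mul ((continuous_oddTent h).measurable.comp
    ((measurable_const.inner h2).sub_const t))

/-- A candidate direction is accepted if it is a unit vector whose empirical jump statistic exceeds
the threshold at the scales `Z⁻⁴³` and `Z⁻¹²`. In units of `Z⁻² ∫ tent`, the threshold `1 / 2` lies
halfway between `3 / 4`, a lower bound for the exact statistic at every `w_i`, and `1 / 4`, an upper
bound at every `-w_j` at the coarse scale and at directions far from all lines at the fine scale. The
sampling error and the error of passing to a nearby direction are each at most `1 / 8`. -/
def Accepted {n m : ℕ} (Z t : ℝ) (v : EuclideanSpace ℝ (Fin n))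
    (z : Fin m → EuclideanSpace ℝ (Fin n) × ℝ) : Prop :=
  ‖v‖ = 1 ∧
    (∫ u, tent (1 / Z ^ 43) u) * (1 / Z ^ 2 * (1 / 2)) ≤ empJumpStat t (1 / Z ^ 43) v z ∧
    (∫ u, tent (1 / Z ^ 12) u) * (1 / Z ^ 2 * (1 / 2)) ≤ empJumpStat t (1 / Z ^ 12) v z

lemma measurable_accepted {n m : ℕ} (Z t : ℝ) (v : EuclideanSpace ℝ (Fin n)) :
    Measurable fun z : Fin m → EuclideanSpace ℝ (Fin n) × ℝ => Accepted Z t v z := by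
  apply measurableSet_setOfPred.1
  exact (MeasurableSet.const _).inter
    ((measurableSet_le measurable_const (measurable_empJumpStat _ _ _)).inter
      (measurableSet_le measurable_const (measurable_empJumpStat _ _ _)))

open Classical in
/-- A `d`-tuple of points of the family `N` with indices in `S` and pairwise distances above `s`,
if there is one, and `0` otherwise. -/
noncomputable def separatedTuple {n : ℕ} {ι : Type*} (d : ℕ) (N : ι → EuclideanSpace ℝ (Fin n))
    (s : ℝ) (S : ι → Prop) : Fin d → EuclideanSpace ℝ (Fin n) :=
  if h : ∃ k : Fin d → ι, (∀ i, S (k i)) ∧ ∀ i j, i ≠ j → s < ‖N (k i) - N (k j)‖ then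
    fun i => N (h.choose i)
  else 0

lemma separatedTuple_spec {n d : ℕ} {ι : Type*} {N : ι → EuclideanSpace ℝ (Fin n)} {s : ℝ}
    {S : ι → Prop}
    (h : ∃ k : Fin d → ι, (∀ i, S (k i)) ∧ ∀ i j, i ≠ j → s < ‖N (k i) - N (k j)‖) :
    (∀ i, ∃ k, S k ∧ separatedTuple d N s S i = N k) ∧
      ∀ i j, i ≠ j → s < ‖separatedTuple d N s S i - separatedTuple d N s S j‖ := by
  have e : separatedTuple d N s S = fun i => N (h.choose i) := dif_pos h
  rw [e]
  exact ⟨fun i => ⟨_, h.choose_spec.1 i, rfl⟩, h.choose_spec.2⟩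

/-- A separated tuple of accepted points of the grid. -/
noncomputable def directionEstimator (n d m M : ℕ) (Z t : ℝ)
    (z : Fin m → EuclideanSpace ℝ (Fin n) × ℝ) : Fin d → EuclideanSpace ℝ (Fin n) :=
  separatedTuple d (sphereGrid n M) (1 / Z ^ 3) fun k => Accepted Z t (sphereGrid n M k) z

lemma measurable_directionEstimator (n d m M : ℕ) (Z t : ℝ) :
    Measurable (directionEstimator n d m M Z t) := by
  have h : Measurable fun (z : Fin m → EuclideanSpace ℝ (Fin n) × ℝ)
      (k : Fin n → Fin (2 * M + 1)) => Accepted Z t (sphereGrid n M k) z :=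
    measurable_pi_iff.2 fun k => measurable_accepted Z t _
  exact (Measurable.of_discrete (f := separatedTuple d (sphereGrid n M) (1 / Z ^ 3))).comp h

/-- Accurate empirical statistics on a fine grid determine the weight vectors. -/
lemma Regular.exists_perm_norm_sub_lt {n d m M : ℕ} {Z : ℝ} {p : (Fin d → ℝ) → ℝ}
    {w : Fin d → EuclideanSpace ℝ (Fin n)} {t : ℝ} (R : Regular Z p w t) (hM : n < M)
    (hMr : 2 * n / M ≤ 1 / Z ^ 94) {z : Fin m → EuclideanSpace ℝ (Fin n) × ℝ}
    (hz : ∀ k, ∀ h ∈ ({1 / Z ^ 43, 1 / Z ^ 12} : Set ℝ),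
      |empJumpStat t h (sphereGrid n M k) z - jumpStat (layerFun p w t) t h (sphereGrid n M k)| <
        1 / Z ^ 92) :
    ∃ σ : Equiv.Perm (Fin d), ∀ i, ‖directionEstimator n d m M Z t z i‖ = 1 ∧
      ‖directionEstimator n d m M Z t z i - w (σ i)‖ < 1 / Z ^ 32 := by
  have hZ := R.two_le
  have hpow : ∀ {a b : ℕ}, a ≤ b → 1 / Z ^ b ≤ 1 / Z ^ a := fun h =>
    one_div_le_one_div_of_le (by positivity) (pow_le_pow_right₀ (by linarith) h)
  have htwo : ∀ a : ℕ, 2 * (1 / Z ^ (a + 1)) ≤ 1 / Z ^ a := by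
    intro a
    calc 2 * (1 / Z ^ (a + 1)) ≤ Z * (1 / Z ^ (a + 1)) := by gcongr
      _ = 1 / Z ^ a := by
        rw [pow_succ]
        field_simp
  have hI43 : 1 / Z ^ 92 ≤ _ := Regular.le_integral_tent_mul hZ 43
  have hI12 := Regular.le_integral_tent_mul hZ 12
  have hacc : 1 / Z ^ 92 ≤ 1 / Z ^ (2 * 12 + 6) := hpow (by norm_num)
  -- accepted grid points are near some weight vector
  have hsound : ∀ k, Accepted Z t (sphereGrid n M k) z →
      ∃ j, ‖sphereGrid n M k - w j‖ < 1 / Z ^ 32 := by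
    rintro k ⟨h1, h2, h3⟩
    have e1 := (abs_lt.1 (hz k (1 / Z ^ 43) (by simp))).2
    have e2 := (abs_lt.1 (hz k (1 / Z ^ 12) (by simp))).2
    exact R.exists_norm_sub_lt h1 (by linarith) (by linarith)
  -- the grid points nearest to the weight vectors are accepted
  have hcomplete : ∀ i, ∃ k, Accepted Z t (sphereGrid n M k) z ∧
      ‖sphereGrid n M k - w i‖ ≤ 1 / Z ^ 94 := by
    intro i
    obtain ⟨k, hk1, hk2⟩ := exists_sphereGrid_near hM (R.norm_eq_one i)
    have hk3 := hk2.trans hMr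
    have hlip : ∀ h : ℝ, 0 ≤ h → -(1 / Z ^ 92) ≤
        jumpStat (layerFun p w t) t h (sphereGrid n M k) -
          jumpStat (layerFun p w t) t h (w i) := by
      intro h hh
      have := (abs_le.1 (abs_jumpStat_sub_le (measurable_layerFun R.measurable w t)
        (R.bound.abs_layerFun_le w t) (t := t) hh (sphereGrid n M k) (w i))).1
      have h2 : 2 * Z * ‖sphereGrid n M k - w i‖ ≤ 1 / Z ^ 92 := by
        calc _ ≤ 2 * Z * (1 / Z ^ 94) := by gcongr
          _ = 2 * (1 / Z ^ 93) := by field_simp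
          _ ≤ 1 / Z ^ 92 := htwo 92
      linarith
    refine ⟨k, ⟨hk1, ?_, ?_⟩, hk3⟩
    · have e1 := (abs_lt.1 (hz k (1 / Z ^ 43) (by simp))).1
      have e2 := hlip (1 / Z ^ 43) (by positivity)
      have e3 := R.le_jumpStat_self i (h := 1 / Z ^ 43) (by positivity) (hpow (by norm_num))
      linarith
    · have e1 := (abs_lt.1 (hz k (1 / Z ^ 12) (by simp))).1
      have e2 := hlip (1 / Z ^ 12) (by positivity)
      have e3 := R.le_jumpStat_self i (h := 1 / Z ^ 12) (by positivity) le_rfl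
      linarith
  choose k hkA hkn using hcomplete
  have hex : ∃ k : Fin d → (Fin n → Fin (2 * M + 1)),
      (∀ i, Accepted Z t (sphereGrid n M (k i)) z) ∧
        ∀ i j, i ≠ j → 1 / Z ^ 3 < ‖sphereGrid n M (k i) - sphereGrid n M (k j)‖ := by
    refine ⟨k, hkA, fun i j hij => ?_⟩
    have h1 := R.norm_sub_ge hij
    have h2 : ‖w i - w j‖ ≤ ‖sphereGrid n M (k i) - w i‖ +
        ‖sphereGrid n M (k i) - sphereGrid n M (k j)‖ + ‖sphereGrid n M (k j) - w j‖ := by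
      calc ‖w i - w j‖ = ‖-(sphereGrid n M (k i) - w i) +
            (sphereGrid n M (k i) - sphereGrid n M (k j)) + (sphereGrid n M (k j) - w j)‖ := by
            congr 1; abel
        _ ≤ _ := (norm_add₃_le).trans (by rw [norm_neg])
    have h3 := hkn i
    have h4 := hkn j
    have h5 : 1 / Z ^ 94 ≤ 1 / Z ^ 5 := hpow (by norm_num)
    have h6 : 2 * (1 / Z ^ 3) ≤ 1 / Z ^ 2 := htwo 2
    have h7 : 2 * (1 / Z ^ 4) ≤ 1 / Z ^ 3 := htwo 3
    have h8 : 2 * (1 / Z ^ 5) ≤ 1 / Z ^ 4 := htwo 4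
    have h9 : 0 < 1 / Z ^ 5 := by positivity
    linarith
  obtain ⟨hmem, hsep⟩ := separatedTuple_spec (N := sphereGrid n M) (s := 1 / Z ^ 3)
    (S := fun k => Accepted Z t (sphereGrid n M k) z) hex
  have hnear : ∀ i, ‖directionEstimator n d m M Z t z i‖ = 1 ∧
      ∃ j, ‖directionEstimator n d m M Z t z i - w j‖ < 1 / Z ^ 32 := by
    intro i
    obtain ⟨k, hk, hk'⟩ := hmem i
    change directionEstimator n d m M Z t z i = _ at hk'
    rw [hk']
    exact ⟨hk.1, hsound k hk⟩
  choose hunit σ hσ using hnear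
  have hinj : Function.Injective σ := by
    intro i j hij
    by_contra hne
    have h1 := hsep i j hne
    change 1 / Z ^ 3 < ‖directionEstimator n d m M Z t z i -
      directionEstimator n d m M Z t z j‖ at h1
    have h2 := hσ i
    have h3 := hσ j
    rw [hij] at h2
    have h4 := norm_sub_le_norm_sub_add_norm_sub (directionEstimator n d m M Z t z i) (w (σ j))
      (directionEstimator n d m M Z t z j)
    rw [norm_sub_rev (w (σ j))] at h4
    have h5 : 1 / Z ^ 32 ≤ 1 / Z ^ 4 := hpow (by norm_num)
    have h6 : 2 * (1 / Z ^ 4) ≤ 1 / Z ^ 3 := htwo 3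
    linarith
  exact ⟨Equiv.ofBijective σ (Finite.injective_iff_bijective.1 hinj),
    fun i => ⟨hunit i, hσ i⟩⟩

/-- With `Z ^ 290 log (2 / δ)` samples the estimator succeeds with probability at least `1 - δ`. -/
lemma Regular.one_sub_le_measureReal {n d m : ℕ} {Z : ℝ} {p : (Fin d → ℝ) → ℝ}
    {w : Fin d → EuclideanSpace ℝ (Fin n)} {t : ℝ} (R : Regular Z p w t) (hn : (n : ℝ) ≤ Z)
    {δ : ℝ} (hδ : 0 < δ) (hδ1 : δ < 1) (hm : Z ^ 290 * Real.log (2 / δ) ≤ m) :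
    1 - δ ≤ (Measure.pi fun _ : Fin m => stdGaussian (EuclideanSpace ℝ (Fin n))).real
      {x | ∃ σ : Equiv.Perm (Fin d), ∀ i,
        ‖directionEstimator n d m ⌈Z ^ 97⌉₊ Z t (labelledSample (layerFun p w t) x) i‖ = 1 ∧
        ‖directionEstimator n d m ⌈Z ^ 97⌉₊ Z t (labelledSample (layerFun p w t) x) i - w (σ i)‖ <
          1 / Z ^ 32} := by
  have hZ := R.two_le
  have hZ1 : 1 ≤ Z := by linarith
  have hB0 := R.bound.nonneg
  set M := ⌈Z ^ 97⌉₊ with hMdef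
  set L := Real.log (2 / δ) with hL
  have hL2 : 1 / 2 ≤ L := by
    have h1 : Real.log 2 ≤ L := Real.log_le_log (by norm_num) (by rw [le_div_iff₀ hδ]; linarith)
    linarith [Real.log_two_gt_d9]
  have hm0 : 0 < m := by
    have : (0 : ℝ) < m := lt_of_lt_of_le (by positivity) hm
    exact_mod_cast this
  have hMle : Z ^ 97 ≤ (M : ℝ) := Nat.le_ceil _
  have hMlt : (M : ℝ) ≤ Z ^ 98 := by
    have h1 := (Nat.ceil_lt_add_one (by positivity : 0 ≤ Z ^ 97)).le
    have h2 : 1 ≤ Z ^ 97 := one_le_pow₀ hZ1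
    calc (M : ℝ) ≤ Z ^ 97 + 1 := h1
      _ ≤ Z ^ 97 * 2 := by linarith
      _ ≤ Z ^ 97 * Z := by gcongr
      _ = Z ^ 98 := by ring
  have hnM : n < M := by
    have h1 : Z ^ 1 < Z ^ 97 := pow_lt_pow_right₀ (by linarith) (by norm_num)
    have : (n : ℝ) < M := by
      rw [pow_one] at h1
      linarith
    exact_mod_cast this
  have hr : 2 * n / M ≤ 1 / Z ^ 94 := by
    calc 2 * (n : ℝ) / M ≤ Z * Z / Z ^ 97 := by gcongr
      _ = 1 / Z ^ 95 := by field_simp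
      _ ≤ 1 / Z ^ 94 := by
        gcongr
        norm_num
  set γ := stdGaussian (EuclideanSpace ℝ (Fin n)) with hγ
  set π := Measure.pi fun _ : Fin m => γ with hπ
  set f := layerFun p w t with hf
  -- the two scales, indexed by `Bool`
  set s : Bool → ℝ := fun b => if b then 1 / Z ^ 43 else 1 / Z ^ 12 with hs
  have hs0 : ∀ b, 0 ≤ s b := by
    intro b
    simp only [hs]
    split_ifs <;> positivity
  have hs1 : ∀ b, s b ≤ 1 := by
    intro b
    simp only [hs]
    split_ifs <;> exact div_le_one_of_le₀ (one_le_pow₀ hZ1) (by positivity)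
  set g : (Fin n → Fin (2 * M + 1)) × Bool → EuclideanSpace ℝ (Fin n) → ℝ := fun q x =>
    f x * oddTent (s q.2) (⟪sphereGrid n M q.1, x⟫ - t) with hg
  have hgm : ∀ q, Measurable (g q) := fun q =>
    (measurable_layerFun R.measurable w t).mul
      ((continuous_oddTent _).measurable.comp (by fun_prop))
  have hgb : ∀ q x, |g q x| ≤ Z := by
    intro q x
    rw [abs_mul]
    calc _ ≤ Z * 1 := mul_le_mul (R.bound.abs_layerFun_le w t x)
          ((abs_oddTent_le (hs0 _) _).trans (hs1 _)) (abs_nonneg _) hB0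
      _ = Z := mul_one Z
  have hbad := measureReal_exists_abs_empMean_sub_ge_le γ hgm hgb hm0 (a := 1 / Z ^ 92)
    (by positivity)
  -- the logarithm of the number of statistics is of order `Z ^ 100`
  have hcard : (Fintype.card ((Fin n → Fin (2 * M + 1)) × Bool) : ℝ) ≤ 2 * Real.exp (Z ^ 100) := by
    have h1 : (Fintype.card ((Fin n → Fin (2 * M + 1)) × Bool) : ℝ) = (2 * M + 1) ^ n * 2 := by
      simp
    have h2 : ((2 : ℝ) * M + 1) ^ n ≤ Real.exp (Z ^ 100) :=
      calc ((2 : ℝ) * M + 1) ^ n ≤ Real.exp (2 * M) ^ n := by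
            gcongr
            exact Real.add_one_le_exp _
        _ = Real.exp (n * (2 * M)) := (Real.exp_nat_mul _ n).symm
        _ ≤ Real.exp (Z * (Z * Z ^ 98)) := by gcongr
        _ = Real.exp (Z ^ 100) := by ring_nf
    rw [h1]
    linarith
  -- the exponent in Hoeffding's inequality beats the union bound and leaves `2 L` for `δ`
  have hexp : Z ^ 100 + 2 * L ≤ m * (1 / Z ^ 92) ^ 2 / (2 * Z ^ 2) := by
    have h1 : Z ^ 103 * L ≤ m * (1 / Z ^ 92) ^ 2 / (2 * Z ^ 2) :=
      calc Z ^ 103 * L = Z ^ 290 * L * (1 / Z ^ 92) ^ 2 / (Z * Z ^ 2) := by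
            field_simp
        _ ≤ m * (1 / Z ^ 92) ^ 2 / (2 * Z ^ 2) := by gcongr
    have h2 : Z ^ 100 * L * 2 ^ 3 ≤ Z ^ 103 * L :=
      calc _ ≤ Z ^ 100 * L * Z ^ 3 := by gcongr
        _ = _ := by ring
    have h3 : Z ^ 100 * (1 / 2) ≤ Z ^ 100 * L := by gcongr
    have h4 : 1 * L ≤ Z ^ 100 * L := by
      gcongr
      exact one_le_pow₀ hZ1
    linarith
  have hδexp : Real.exp (-(2 * L)) = (δ / 2) ^ 2 := by
    rw [show -(2 * L) = -L + -L by ring, Real.exp_add, Real.exp_neg, hL, Real.exp_log (by positivity),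
      inv_div, sq]
  have hbadδ : π.real {x | ∃ q, 1 / Z ^ 92 ≤ |empMean (g q) x - ∫ y, g q y ∂γ|} ≤ δ := by
    refine hbad.trans ?_
    calc _ ≤ 2 * Real.exp (Z ^ 100) * (2 * Real.exp (-(Z ^ 100 + 2 * L))) := by gcongr
      _ = 4 * Real.exp (-(2 * L)) := by
        rw [show -(Z ^ 100 + 2 * L) = -(Z ^ 100) + -(2 * L) by ring, Real.exp_add, Real.exp_neg]
        field_simp
        norm_num
      _ = δ * δ := by rw [hδexp]; ring
      _ ≤ δ := mul_le_of_le_one_left hδ.le hδ1.le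
  set good : Set (Fin m → EuclideanSpace ℝ (Fin n)) := {x | ∃ σ : Equiv.Perm (Fin d), ∀ i,
        ‖directionEstimator n d m M Z t (labelledSample f x) i‖ = 1 ∧
        ‖directionEstimator n d m M Z t (labelledSample f x) i - w (σ i)‖ < 1 / Z ^ 32}
  have hcover : Set.univ ⊆ good ∪
      {x | ∃ q, 1 / Z ^ 92 ≤ |empMean (g q) x - ∫ y, g q y ∂γ|} := by
    intro x _
    by_contra hx
    rw [Set.mem_union, not_or] at hx
    obtain ⟨hx1, hx2⟩ := hx
    simp only [Set.mem_ofPred_eq, not_exists, not_le] at hx2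
    refine hx1 (R.exists_perm_norm_sub_lt hnM hr fun k h hh => ?_)
    rcases hh with rfl | rfl
    · exact hx2 (k, true)
    · exact hx2 (k, false)
  have hone : (1 : ℝ) ≤ π.real good +
      π.real {x | ∃ q, 1 / Z ^ 92 ≤ |empMean (g q) x - ∫ y, g q y ∂γ|} :=
    calc (1 : ℝ) = π.real Set.univ := probReal_univ.symm
      _ ≤ _ := measureReal_mono hcover
      _ ≤ _ := measureReal_union_le _ _
  linarith

/-! ### From the polynomial model to the normalized assumptions -/

/-- For a polynomial of degree at most one in `X_i`, the discrete derivative in the direction `i`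
is the partial derivative. -/
lemma eval_update_one_sub_eval_update_zero {d : ℕ} (P : MvPolynomial (Fin d) ℝ) (i : Fin d)
    (hP : P.degreeOf i ≤ 1) (X : Fin d → ℝ) :
    MvPolynomial.eval (Function.update X i 1) P - MvPolynomial.eval (Function.update X i 0) P =
      MvPolynomial.eval X (MvPolynomial.pderiv i P) := by
  have hmon : ∀ m ∈ P.support,
      MvPolynomial.eval (Function.update X i 1) (MvPolynomial.monomial m (P.coeff m)) -
        MvPolynomial.eval (Function.update X i 0) (MvPolynomial.monomial m (P.coeff m)) =
      MvPolynomial.eval X (MvPolynomial.pderiv i (MvPolynomial.monomial m (P.coeff m))) := by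
    intro m hm
    have hmi : m i ≤ 1 := MvPolynomial.degreeOf_le_iff.1 hP m hm
    have hupd : ∀ a : ℝ, ∏ j, Function.update X i a j ^ m j =
        a ^ m i * ∏ j ∈ Finset.univ.erase i, X j ^ m j := by
      intro a
      rw [← Finset.mul_prod_erase _ _ (Finset.mem_univ i), Function.update_self]
      congr 1
      refine Finset.prod_congr rfl fun j hj => ?_
      rw [Function.update_of_ne (Finset.ne_of_mem_erase hj)]
    rw [MvPolynomial.pderiv_monomial]
    simp only [MvPolynomial.eval_monomial, Finsupp.prod_pow, hupd]
    rcases Nat.le_one_iff_eq_zero_or_eq_one.1 hmi with h | h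
    · simp [h]
    · rw [← Finset.mul_prod_erase _ _ (Finset.mem_univ i)]
      have : ∏ j ∈ Finset.univ.erase i, X j ^ (m - fun₀ | i => 1) j =
          ∏ j ∈ Finset.univ.erase i, X j ^ m j := by
        refine Finset.prod_congr rfl fun j hj => ?_
        simp [(Finset.ne_of_mem_erase hj).symm]
      rw [this]
      simp [h]
  conv_lhs => rw [← P.support_sum_monomial_coeff]
  conv_rhs => rw [← P.support_sum_monomial_coeff]
  simp only [map_sum]
  rw [← Finset.sum_sub_distrib]
  exact Finset.sum_congr rfl hmon

/-- Unit vectors with angle in `[τ, π - τ]` have squared sine at least `(τ / 2)²`. -/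
lemma sq_half_le_one_sub_inner_sq {n : ℕ} {v w : EuclideanSpace ℝ (Fin n)} (hv : ‖v‖ = 1)
    (hw : ‖w‖ = 1) {τ : ℝ} (hτ : 0 ≤ τ) (h1 : τ ≤ angle v w) (h2 : angle v w ≤ Real.pi - τ) :
    (τ / 2) ^ 2 ≤ 1 - ⟪v, w⟫ ^ 2 := by
  have hcos : ⟪v, w⟫ = Real.cos (angle v w) := by rw [cos_angle, hv, hw]; simp
  have hsq : 1 - ⟪v, w⟫ ^ 2 = Real.sin (angle v w) ^ 2 := by
    rw [hcos, ← Real.sin_sq_add_cos_sq (angle v w)]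
    ring
  rw [hsq]
  have hconst : τ / 2 ≤ 2 / Real.pi * τ := by
    have : 1 / 2 ≤ 2 / Real.pi := by
      rw [div_le_div_iff₀ (by norm_num) Real.pi_pos]
      linarith [Real.pi_le_four]
    nlinarith
  have hpi : 0 ≤ 2 / Real.pi := by positivity
  gcongr
  rcases le_total (angle v w) (Real.pi / 2) with h | h
  · calc τ / 2 ≤ 2 / Real.pi * τ := hconst
      _ ≤ 2 / Real.pi * angle v w := by gcongr
      _ ≤ _ := Real.mul_le_sin (angle_nonneg _ _) h
  · rw [← Real.sin_pi_sub]
    calc τ / 2 ≤ 2 / Real.pi * τ := hconst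
      _ ≤ 2 / Real.pi * (Real.pi - angle v w) := by
        gcongr
        linarith
      _ ≤ _ := Real.mul_le_sin (by linarith [angle_le_pi v w]) (by linarith)

lemma angle_le_of_norm_sub_le {n : ℕ} {v w : EuclideanSpace ℝ (Fin n)} (hv : ‖v‖ = 1)
    (hw : ‖w‖ = 1) {ε : ℝ} (hε : 0 ≤ ε) (hε1 : ε ≤ 1) (h : ‖v - w‖ ≤ ε / 2) :
    angle v w ≤ ε := by
  have hin : 1 - ε ^ 2 / 8 ≤ ⟪v, w⟫ := by
    have h1 : ‖v - w‖ ^ 2 ≤ (ε / 2) ^ 2 := by gcongr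
    rw [norm_sub_sq_of_unit hv hw] at h1
    linarith
  have hpi : |ε| ≤ Real.pi := by
    rw [abs_of_nonneg hε]
    linarith [Real.pi_gt_three]
  have hcos : Real.cos ε ≤ ⟪v, w⟫ := by
    have h1 := Real.cos_le_one_sub_mul_cos_sq hpi
    have h2 : 1 / 8 ≤ 2 / Real.pi ^ 2 := by
      rw [div_le_div_iff₀ (by norm_num) (by positivity)]
      nlinarith [Real.pi_le_four, Real.pi_pos]
    nlinarith [sq_nonneg ε]
  rw [angle, hv, hw, mul_one, div_one]
  calc Real.arccos ⟪v, w⟫ ≤ Real.arccos (Real.cos ε) := Real.arccos_le_arccos hcos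
    _ = ε := Real.arccos_cos hε (by linarith [Real.pi_gt_three])

lemma abs_eval_le_of_le_norm_rpow {d : ℕ} {P : MvPolynomial (Fin d) ℝ} {c : ℝ} (hc : 0 ≤ c)
    (hP : ∀ X : EuclideanSpace ℝ (Fin d), (∀ i, X i = 0 ∨ X i = 1) →
      |MvPolynomial.eval (fun i => X i) P| ≤ ‖X‖ ^ c) :
    CubeBound (fun X => MvPolynomial.eval X P) (((d : ℝ) + 1) ^ c) := by
  intro X hX
  refine (hP (WithLp.toLp 2 X) hX).trans (Real.rpow_le_rpow (norm_nonneg _) ?_ hc)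
  have h : ‖(WithLp.toLp 2 X : EuclideanSpace ℝ (Fin d))‖ ≤ d * 1 :=
    norm_le_card_mul_of_abs_le fun i => by
      rcases hX i with h | h <;> simp [h]
  linarith

theorem mainTheorem5 (c₁ c₂ : ℝ) (hc₁ : 0 ≤ c₁) (hc₂ : 0 ≤ c₂) :
    ∃ C : ℝ, 0 < C ∧
      ∀ (n d : ℕ), (n : ℝ) ≤ ((d : ℝ) + 1) ^ c₂ →
      ∀ t : ℝ, ((d : ℝ) + 1) ^ (-c₂) ≤ gaussianPDFReal 0 1 t →
      ∀ ε₂ ε₃ δ : ℝ, 0 < ε₂ → ε₂ ≤ 1 → 0 < ε₃ → ε₃ ≤ 1 → 0 < δ → δ < 1 →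
      ∀ m : ℕ, C * ((d : ℝ) / (ε₃ * ε₂)) ^ C * Real.log (2 / δ) ≤ (m : ℝ) →
      ∃ A : (Fin m → EuclideanSpace ℝ (Fin n) × ℝ) → (Fin d → EuclideanSpace ℝ (Fin n)),
        Measurable A ∧
        ∀ (w : Fin d → EuclideanSpace ℝ (Fin n)) (P : MvPolynomial (Fin d) ℝ),
          (∀ i, ‖w i‖ = 1) →
          (∀ i j, i ≠ j → ((d : ℝ) + 1) ^ (-c₂) ≤ angle (w i) (w j) ∧
            angle (w i) (w j) ≤ Real.pi - ((d : ℝ) + 1) ^ (-c₂)) →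
          (∀ i, P.degreeOf i ≤ 1) →
          (∀ X : EuclideanSpace ℝ (Fin d), (∀ i, X i = 0 ∨ X i = 1) →
            |MvPolynomial.eval (fun i => X i) P| ≤ ‖X‖ ^ c₁) →
          (∀ i, ε₃ ≤ condMeanOnHyperplane (w i) t (evalAt (MvPolynomial.pderiv i P) w t)) →
          1 - δ ≤ (Measure.pi fun _ : Fin m => stdGaussian (EuclideanSpace ℝ (Fin n))).real
            {x | RecoversWithin ε₂ (A (labelledSample (evalAt P w t) x)) w} := by
  obtain ⟨N, hN1, hNc₁, hNc₂⟩ : ∃ N : ℕ, 1 ≤ N ∧ c₁ ≤ N ∧ c₂ ≤ N := by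
    refine ⟨⌈max c₁ c₂⌉₊ + 1, by omega, ?_, ?_⟩ <;> push_cast
    · linarith [Nat.le_ceil (max c₁ c₂), le_max_left c₁ c₂]
    · linarith [Nat.le_ceil (max c₁ c₂), le_max_right c₁ c₂]
  refine ⟨2 ^ (290 * N), by positivity, ?_⟩
  intro n d hn t ht ε₂ ε₃ δ hε₂ hε₂1 hε₃ hε₃1 hδ hδ1 m hm
  rcases Nat.eq_zero_or_pos d with rfl | hd
  · -- there is nothing to recover
    refine ⟨fun _ => 0, measurable_const, fun w P _ _ _ _ _ => ?_⟩
    have : {x : Fin m → EuclideanSpace ℝ (Fin n) |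
        RecoversWithin ε₂ ((fun _ => 0 : (Fin m → EuclideanSpace ℝ (Fin n) × ℝ) →
          Fin 0 → EuclideanSpace ℝ (Fin n)) (labelledSample (evalAt P w t) x)) w} = Set.univ :=
      Set.eq_univ_of_forall fun x => ⟨1, fun i => i.elim0⟩
    rw [this, probReal_univ]
    linarith
  have hd1 : (1 : ℝ) ≤ d := by exact_mod_cast hd
  have hlog : 0 ≤ Real.log (2 / δ) := Real.log_nonneg (by rw [le_div_iff₀ hδ]; linarith)
  set y : ℝ := (d : ℝ) / (ε₃ * ε₂) with hy
  have hy3 : 1 / ε₃ ≤ y := by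
    rw [hy, div_le_div_iff₀ hε₃ (by positivity)]
    nlinarith [mul_le_mul hd1 hε₂1 hε₂.le (by linarith)]
  have hy2 : 1 / ε₂ ≤ y := by
    rw [hy, div_le_div_iff₀ hε₂ (by positivity)]
    nlinarith [mul_le_mul hd1 hε₃1 hε₃.le (by linarith)]
  have hyd : (d : ℝ) ≤ y := by
    rw [hy, le_div_iff₀ (by positivity)]
    exact mul_le_of_le_one_right (by linarith) (mul_le_one₀ hε₃1 hε₂.le hε₂1)
  have hy1 : 1 ≤ y := hd1.trans hyd
  -- all parameters are compared with powers of the single size `Z`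
  set Z : ℝ := (2 * y) ^ N with hZdef
  have hyZ : 2 * y ≤ Z := le_self_pow₀ (by linarith) (by omega)
  have hZ2 : 2 ≤ Z := by linarith
  have hpoly : ∀ c : ℝ, 0 ≤ c → c ≤ N → ((d : ℝ) + 1) ^ c ≤ Z := by
    intro c hc hcN
    calc ((d : ℝ) + 1) ^ c ≤ (2 * y) ^ c :=
          Real.rpow_le_rpow (by positivity) (by linarith) hc
      _ ≤ (2 * y) ^ (N : ℝ) := Real.rpow_le_rpow_of_exponent_le (by linarith) hcN
      _ = Z := Real.rpow_natCast _ _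
  have hτ : 1 / Z ≤ ((d : ℝ) + 1) ^ (-c₂) := by
    rw [Real.rpow_neg (by positivity), one_div]
    exact inv_anti₀ (by positivity) (hpoly c₂ hc₂ hNc₂)
  have hmZ : Z ^ 290 * Real.log (2 / δ) ≤ m := by
    refine le_trans ?_ hm
    gcongr
    have hexp : ((290 * N : ℕ) : ℝ) ≤ 2 ^ (290 * N) := by
      exact_mod_cast (Nat.lt_two_pow_self (n := 290 * N)).le
    calc Z ^ 290 = 2 ^ (290 * N) * y ^ (290 * N) := by
          rw [hZdef, ← pow_mul, mul_comm N 290, mul_pow]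
      _ = 2 ^ (290 * N) * y ^ ((290 * N : ℕ) : ℝ) := by rw [Real.rpow_natCast]
      _ ≤ 2 ^ (290 * N) * y ^ ((2 : ℝ) ^ (290 * N)) := by
          gcongr
  refine ⟨directionEstimator n d m ⌈Z ^ 97⌉₊ Z t, measurable_directionEstimator _ _ _ _ _ _, ?_⟩
  intro w P hw hang hdeg hbound hjump
  have R : Regular Z (fun X => MvPolynomial.eval X P) w t := by
    refine ⟨hZ2, by linarith, (MvPolynomial.continuous_eval P).measurable, fun X hX => ?_, hw,
      fun i j hij => ?_, hτ.trans ht, fun i => ?_⟩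
    · exact (abs_eval_le_of_le_norm_rpow hc₁ hbound X hX).trans (hpoly c₁ hc₁ hNc₁)
    · refine le_trans ?_ (sq_half_le_one_sub_inner_sq (hw i) (hw j)
        (by positivity : (0 : ℝ) ≤ 1 / Z) (hτ.trans (hang i j hij).1)
        (by linarith [(hang i j hij).2]))
      refine pow_le_pow_left₀ (by positivity) ?_ 2
      rw [div_div]
      exact one_div_le_one_div_of_le (by positivity) (by nlinarith)
    · have e : layerFun (fun X => MvPolynomial.eval (Function.update X i 1) P -
          MvPolynomial.eval (Function.update X i 0) P) w t =
          evalAt (MvPolynomial.pderiv i P) w t :=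
        funext fun x => eval_update_one_sub_eval_update_zero P i (hdeg i) _
      rw [e]
      refine le_trans ?_ (hjump i)
      rw [one_div_le (by positivity) hε₃]
      linarith
  refine (R.one_sub_le_measureReal (hn.trans (hpoly c₂ hc₂ hNc₂)) hδ hδ1 hmZ).trans
    (measureReal_mono ?_)
  rintro x ⟨σ, hσ⟩
  refine ⟨σ, fun i => ⟨(hσ i).1, angle_le_of_norm_sub_le (hσ i).1 (hw _) hε₂.le hε₂1 ?_⟩⟩
  refine (hσ i).2.le.trans ?_
  have h1 : 1 / (2 * y) ≤ ε₂ / 2 := by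
    rw [div_le_div_iff₀ (by positivity) (by norm_num)]
    rw [div_le_iff₀ hε₂] at hy2
    linarith
  refine le_trans ?_ h1
  apply one_div_le_one_div_of_le (by positivity)
  exact hyZ.trans (le_self_pow₀ (by linarith) (by norm_num))
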